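/- Identify $\Delta_X$ with the set of probability distributions on a finite set $X$; hypotheses are functions $X\to\{-1,1\}$, and the concept to be learned is the all-ones function, so that $\mathcal L_{D}(f)=\Pr_{x\sim D}[f(x)\neq 1]$. A weak learner is viewed as a function $W:\Delta_X\to\{-1,1\}^X$; it has advantage $\gamma$ for the all-ones concept if $\sum_{x}D(x)\,W(D)(x)\ge 2\gamma$ for every $D\in\Delta_X$. A learning algorithm $\mathcal A$ receives a labelled training sample $S$ of size $m$ and may adaptively send finitely many queries to a weak learner $W$, each consisting of a distribution in $\Delta_X$ and labels for the sample items, before it outputs a classifier $\mathcal A(S,W)$. Consider the following properties, for all samples $S$ labelled by the all-ones concept and all weak learners $W$ of advantage $\gamma$ for that concept. (1) $\mathcal A(S,W)=\operatorname{sign}(\sum_i w_ih_i)$, where the $h_i$ are the hypotheses that were obtained from $W$, $w_i\ge 0$ and $\sum_i w_i=1$, and the weights are a function only of $S$ and of the values of the $h_i$ on the points of $S$ (here $\operatorname{sign}(0)=1$). (2) Every queried distribution has support exactly the set of points of $S$. (3) Every query carries the true labels of the sample items. Theorem. There are universal constants $0<c\le 1$ and $K,C,p>0$ such that the following holds for all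 real $0<\gamma\le c$, all real $d\ge\ln(1/\gamma)$ and all integers $m$ with $d\gamma^{-2}/16\le m\le\exp(\exp(d))$. There exist a finite universe $X=[u]$, with $\mathcal D$ the uniform distribution on $X$, a set $\mathcal H$ of hypotheses on $X$ of VC-dimension at most $Kd$, and a weak learner $W_{\mathcal H}:\Delta_X\to\mathcal H$ with $$\sum_{i\in[u]}D(i)\,W_{\mathcal H}(D)(i)\ge 2\gamma\qquad\text{for all }D\in\Delta_X,$$ such that every learning algorithm $\mathcal A$ with properties (1), (2) and (3) satisfies $$\Pr_{S\sim\mathcal D^m}\left[\mathcal L_{\mathcal D}(\mathcal A(S,W_{\mathcal H}))\ \ge\ C\,\frac{d\ln(m\gamma^2/d)}{m\gamma^2}\right]\ \ge\ p .$$ -/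

import Mathlib

/-- The labels `-1` and `1`. -/
abbrev Label : Type := ℤˣ

/-- A hypothesis (or a concept) on `X` assigns a label to every point. -/
abbrev Hypothesis (X : Type) : Type := X → Label

/-- A label seen as a real number. -/
def Label.toReal (a : Label) : ℝ := ((a : ℤ) : ℝ)

/-- The set `Δ_X` of probability distributions on a finite universe. -/
abbrev ProbDist (X : Type) [Fintype X] : Type := stdSimplex ℝ X

/-- A labelled training sample of size `m`, with repetitions allowed. -/
abbrev LabelledSample (X : Type) (m : ℕ) : Type := Fin m → X × Label

/-- The sample points `s` together with their labels under the concept `c`. -/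
def labelled {X : Type} {m : ℕ} (c : Hypothesis X) (s : Fin m → X) : LabelledSample X m :=
  fun j => (s j, c (s j))

/-- The VC-dimension of a finite set of hypotheses on a finite universe, that is, of the family of
the sets on which the hypotheses are `1`. -/
def hypVCDim {X : Type} [Fintype X] [DecidableEq X] (H : Finset (Hypothesis X)) : ℕ :=
  (H.image fun h => Finset.univ.filter fun x => h x = 1).vcDim

/-- `W` is a weak learner for the concept `c`: under every distribution `D` it returns a hypothesis
with `∑ x, D x * c x * (W D) x ≥ 2 γ`, i.e. with error at most `1/2 - γ`. -/
def IsWeakLearner {X : Type} [Fintype X] (γ : ℝ) (c : Hypothesis X)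
    (W : ProbDist X → Hypothesis X) : Prop :=
  ∀ D : ProbDist X, 2 * γ ≤ ∑ x, D x * ((c x).toReal * (W D x).toReal)

/-- The error `Pr_{x ∼ D} [f x ≠ c x]` of `f` with respect to the concept `c`. -/
noncomputable def errorRate {X : Type} [Fintype X] (D : ProbDist X) (c f : Hypothesis X) : ℝ :=
  ∑ x with f x ≠ c x, D x

/-- The probability of the event `E` over `m` independent samples from `D`. -/
noncomputable def sampleProb {X : Type} [Fintype X] (D : ProbDist X) (m : ℕ)
    (E : (Fin m → X) → Prop) : ℝ :=
  open Classical in ∑ s : Fin m → X with E s, ∏ j, D (s j)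

/-- The voting classifier `x ↦ sign (∑ i, w i * h i x)`, where the sign of `0` is `1`. -/
noncomputable def vote {X : Type} {n : ℕ} (w : Fin n → ℝ) (h : Fin n → Hypothesis X) :
    Hypothesis X :=
  fun x => if ∑ i, w i * (h i x).toReal < 0 then -1 else 1

/-- A query to the weak learner: a distribution on the universe, and a label for each item of the
training sample. -/
structure Query (X : Type) [Fintype X] (m : ℕ) where
  dist : ProbDist X
  labels : Fin m → Label

/-- A terminating, adaptive interaction with a weak learner: either stop and output a classifier,
or send a query and continue depending on the hypothesis that is returned. -/
inductive Interaction (X : Type) [Fintype X] (m : ℕ) where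
  | output (f : Hypothesis X) : Interaction X m
  | query (q : Query X m) (next : Hypothesis X → Interaction X m) : Interaction X m

namespace Interaction

variable {X : Type} [Fintype X] {m : ℕ}

/-- The queries asked, in order, when the weak learner is `W`. -/
def queries (W : ProbDist X → Hypothesis X) : Interaction X m → List (Query X m)
  | output _ => []
  | query q next => q :: queries W (next (W q.dist))

/-- The hypotheses obtained from the weak learner `W`, in order. -/
def hypotheses (W : ProbDist X → Hypothesis X) : Interaction X m → List (Hypothesis X)
  | output _ => []
  | query q next => W q.dist :: hypotheses W (next (W q.dist))

/-- The classifier that is finally output when the weak learner is `W`. -/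
def result (W : ProbDist X → Hypothesis X) : Interaction X m → Hypothesis X
  | output f => f
  | query q next => result W (next (W q.dist))

end Interaction

/-- A learning algorithm (for samples of size `m`) with access to a weak learner: it reads the
labelled training sample and then interacts with the weak learner. -/
abbrev LearningAlgorithm (X : Type) [Fintype X] (m : ℕ) : Type :=
  LabelledSample X m → Interaction X m

/-- The three properties of a learning algorithm `A`, run on samples labelled by the concept `c`
and with weak learners for `c` of advantage `γ`. -/
structure SatisfiesProperties {X : Type} [Fintype X] {m : ℕ} (γ : ℝ) (c : Hypothesis X)
    (A : LearningAlgorithm X m) : Prop where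
  /-- The output is a weighted majority vote of the hypotheses obtained from the weak learner. The
  weights are non-negative, sum to one, and are a function `ω` of the training sample and of the
  values that the obtained hypotheses take on the training sample only. -/
  weightedMajority :
    ∃ ω : LabelledSample X m → (n : ℕ) → (Fin n → Fin m → Label) → Fin n → ℝ,
      ∀ (s : Fin m → X) (W : ProbDist X → Hypothesis X), IsWeakLearner γ c W →
        let hs := (A (labelled c s)).hypotheses W
        let w := ω (labelled c s) hs.length fun i j => hs.get i (s j)
        w ∈ stdSimplex ℝ (Fin hs.length) ∧ (A (labelled c s)).result W = vote w hs.get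
  /-- Every queried distribution is positive exactly on the points of the training sample. -/
  fullSupport :
    ∀ (s : Fin m → X) (W : ProbDist X → Hypothesis X), IsWeakLearner γ c W →
      ∀ q ∈ (A (labelled c s)).queries W, ∀ x, 0 < q.dist x ↔ x ∈ Set.range s
  /-- Every query carries the true labels of the items of the training sample. -/
  trueLabels :
    ∀ (s : Fin m → X) (W : ProbDist X → Hypothesis X), IsWeakLearner γ c W →
      ∀ q ∈ (A (labelled c s)).queries W, ∀ j, q.labels j = c (s j)

/-! Take a universe of order `m / ln(mγ²/d)` points (up to a floor on the logarithm). By a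
coupon-collector count, a sample `S` misses, with probability at least 1/2, a set `T` of order
`d/γ²` points, a fraction of order `d ln(mγ²/d) / (mγ²)` of the universe. It suffices that queries
supported on `S` are answered from a family as in `IsTrappingFamily`: its average has margin `2γ`
off `T`, so under every distribution on `S` some member has advantage `γ`; yet every convex
combination of members is negative on a constant fraction of `T`. A learner whose queries have
support `S` sees only this family, however adaptive it is, and no choice of weights helps.

Independent random hypotheses with labels of mean `4γ` off `T` and `-4γ` on `T` typically form such
a family. A fixed weighted vote falls below its mean at each point of `T` with probability at least
1/21, independently over the points. Sampling replaces arbitrary weights by averages of `k ≈ 42/γ²`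
members (`exists_sparse_vote`), and a union bound over the `n^k` tuples succeeds because `|T|` is a
large multiple of `k d`.

The class must have VC-dimension `O(d)`, while `T` varies with `S`. So the class is a single random
array drawn from the law of mean `4γ` everywhere, which ignores `T`. Conditioned on the sum of the
labels on `T`, this law and the one biased on `T` coincide (`lawOn_empty_eq`), and some slice has
probability `exp(-O(γ²|T|)) = exp(-O(d))`, up to a factor linear in `|T|`, under the unbiased law.
By rejection sampling, an array of `exp(O(d))` draws contains a trapping family for any given `T`
with probability at least 1/2 (`wprob_no_trapping_selection_le`). Averaging over the samples fixes
one array that serves a quarter of them, and the logarithm of its size bounds the VC-dimension. -/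

open Finset Function

/-! ### Finite probability: product weights and moments. -/

section WeightedSums

variable {Ω ι : Type*} [Fintype Ω]

/-- The mean of `F` under the weights `μ`. -/
def wmean (μ F : Ω → ℝ) : ℝ := ∑ x, μ x * F x

/-- The probability of the event `p` under the weights `μ`. -/
noncomputable def wprob (μ : Ω → ℝ) (p : Ω → Prop) : ℝ :=
  open Classical in ∑ x with p x, μ x

lemma wmean_add (μ F G : Ω → ℝ) :
    wmean μ (fun x => F x + G x) = wmean μ F + wmean μ G := by
  simp [wmean, mul_add, sum_add_distrib]

lemma wmean_const_mul (μ F : Ω → ℝ) (a : ℝ) :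
    wmean μ (fun x => a * F x) = a * wmean μ F := by
  simp only [wmean, mul_sum]
  exact sum_congr rfl fun x _ => by ring

lemma wmean_sum {κ : Type*} (s : Finset κ) (μ : Ω → ℝ) (F : κ → Ω → ℝ) :
    wmean μ (fun x => ∑ i ∈ s, F i x) = ∑ i ∈ s, wmean μ (F i) := by
  simp only [wmean, mul_sum]
  exact sum_comm

lemma wmean_const {μ : Ω → ℝ} (hμ : μ ∈ stdSimplex ℝ Ω) (a : ℝ) : wmean μ (fun _ => a) = a := by
  rw [wmean, ← sum_mul, hμ.2, one_mul]

lemma wmean_mono {μ F G : Ω → ℝ} (hμ : ∀ x, 0 ≤ μ x) (h : ∀ x, F x ≤ G x) :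
    wmean μ F ≤ wmean μ G :=
  sum_le_sum fun x _ => mul_le_mul_of_nonneg_left (h x) (hμ x)

lemma wmean_nonneg {μ F : Ω → ℝ} (hμ : ∀ x, 0 ≤ μ x) (h : ∀ x, 0 ≤ F x) : 0 ≤ wmean μ F :=
  sum_nonneg fun x _ => mul_nonneg (hμ x) (h x)

lemma wprob_eq_wmean (μ : Ω → ℝ) (p : Ω → Prop) [DecidablePred p] :
    wprob μ p = wmean μ (fun x => if p x then 1 else 0) := by
  classical
  simp only [wprob, wmean, mul_ite, mul_one, mul_zero, sum_filter]
  exact sum_congr rfl fun x _ => by congr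

lemma wprob_nonneg {μ : Ω → ℝ} (hμ : ∀ x, 0 ≤ μ x) (p : Ω → Prop) : 0 ≤ wprob μ p :=
  sum_nonneg fun x _ => hμ x

lemma wprob_mono {μ : Ω → ℝ} (hμ : ∀ x, 0 ≤ μ x) {p q : Ω → Prop} (h : ∀ x, p x → q x) :
    wprob μ p ≤ wprob μ q := by
  classical
  exact sum_le_sum_of_subset_of_nonneg (fun x hx => by simp_all) fun x _ _ => hμ x

lemma wprob_le_wmean {μ F : Ω → ℝ} (hμ : ∀ x, 0 ≤ μ x) (hF : ∀ x, 0 ≤ F x) {p : Ω → Prop}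
    (h : ∀ x, p x → 1 ≤ F x) : wprob μ p ≤ wmean μ F := by
  classical
  rw [wprob_eq_wmean]
  refine wmean_mono hμ fun x => ?_
  split_ifs with hp
  · exact h x hp
  · exact hF x

lemma wprob_add_not {μ : Ω → ℝ} (hμ : μ ∈ stdSimplex ℝ Ω) (p : Ω → Prop) :
    wprob μ p + wprob μ (fun x => ¬ p x) = 1 := by
  classical
  rw [wprob, wprob, ← hμ.2]
  convert sum_filter_add_sum_filter_not univ p μ

lemma wprob_le_one {μ : Ω → ℝ} (hμ : μ ∈ stdSimplex ℝ Ω) (p : Ω → Prop) : wprob μ p ≤ 1 := by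
  have := wprob_add_not hμ p
  have := wprob_nonneg hμ.1 fun x => ¬ p x
  linarith

lemma wprob_or_le {μ : Ω → ℝ} (hμ : ∀ x, 0 ≤ μ x) (p q : Ω → Prop) :
    wprob μ (fun x => p x ∨ q x) ≤ wprob μ p + wprob μ q := by
  classical
  rw [wprob_eq_wmean μ p, wprob_eq_wmean μ q, ← wmean_add]
  refine wprob_le_wmean hμ (fun x => by positivity) fun x hx => ?_
  rcases hx with hx | hx <;> simp only [hx, if_true] <;> split_ifs <;> norm_num

lemma wprob_exists_le {κ : Type*} (s : Finset κ) {μ : Ω → ℝ} (hμ : ∀ x, 0 ≤ μ x)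
    (p : κ → Ω → Prop) :
    wprob μ (fun x => ∃ i ∈ s, p i x) ≤ ∑ i ∈ s, wprob μ (p i) := by
  classical
  simp only [fun i => wprob_eq_wmean μ (p i)]
  rw [← wmean_sum]
  refine wprob_le_wmean hμ (fun x => sum_nonneg fun i _ => by positivity) fun x hx => ?_
  obtain ⟨i, hi, hp⟩ := hx
  refine le_trans ?_ (single_le_sum (f := fun i => if p i x then (1 : ℝ) else 0)
    (fun j _ => by positivity) hi)
  simp [hp]

lemma exists_le_of_wmean_le {μ F : Ω → ℝ} {a : ℝ} (hμ : μ ∈ stdSimplex ℝ Ω)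
    (h : wmean μ F ≤ a) : ∃ x, F x ≤ a := by
  by_contra! hc
  obtain ⟨x, hx⟩ : ∃ x, 0 < μ x := by
    by_contra! h0
    have := sum_nonpos fun x (_ : x ∈ univ) => h0 x
    have := hμ.2
    linarith
  have : wmean μ (fun _ => a) < wmean μ F :=
    sum_lt_sum (fun x _ => mul_le_mul_of_nonneg_left (hc x).le (hμ.1 x))
      ⟨x, mem_univ _, mul_lt_mul_of_pos_left (hc x) hx⟩
  rw [wmean_const hμ] at this
  linarith

variable [Fintype ι]

/-- The weights of independent draws from the weights `b i`. -/
def piWeight (b : ι → Ω → ℝ) (ω : ι → Ω) : ℝ := ∏ i, b i (ω i)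

omit [Fintype Ω] in
lemma piWeight_nonneg {b : ι → Ω → ℝ} (hb : ∀ i x, 0 ≤ b i x) (ω : ι → Ω) :
    0 ≤ piWeight b ω :=
  prod_nonneg fun i _ => hb i _

lemma sum_prod_eval [DecidableEq ι] (f : ι → Ω → ℝ) :
    ∑ ω : ι → Ω, ∏ i, f i (ω i) = ∏ i, ∑ x, f i x := by
  rw [prod_univ_sum, Fintype.piFinset_univ]

lemma wmean_piWeight_prod [DecidableEq ι] (b F : ι → Ω → ℝ) :
    wmean (piWeight b) (fun ω => ∏ i, F i (ω i)) = ∏ i, wmean (b i) (F i) := by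
  simp only [wmean, piWeight, ← prod_mul_distrib]
  exact sum_prod_eval fun i x => b i x * F i x

lemma piWeight_mem_stdSimplex [DecidableEq ι] {b : ι → Ω → ℝ} (hb : ∀ i, b i ∈ stdSimplex ℝ Ω) :
    piWeight b ∈ stdSimplex ℝ (ι → Ω) := by
  refine ⟨piWeight_nonneg fun i => (hb i).1, ?_⟩
  simp only [piWeight]
  rw [sum_prod_eval]
  exact prod_eq_one fun i _ => (hb i).2

variable [DecidableEq ι]

/-- Exchanging one coordinate with an independent draw. -/
def swapCoordinate (i : ι) : ((ι → Ω) × Ω) ≃ ((ι → Ω) × Ω) :=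
  Involutive.toPerm (fun q => (update q.1 i q.2, q.1 i)) fun q => by simp

omit [Fintype Ω] in
lemma piWeight_update (b : ι → Ω → ℝ) (i : ι) (β : Ω → ℝ) (ω : ι → Ω) (x : Ω) :
    piWeight b (update ω i x) * β (ω i) = piWeight (update b i β) ω * b i x := by
  rw [piWeight, piWeight, ← mul_prod_erase univ _ (mem_univ i), ← mul_prod_erase univ _ (mem_univ i)]
  have : ∀ j ∈ univ.erase i, b j (update ω i x j) = update b i β j (ω j) := by
    intro j hj
    simp [update_of_ne (ne_of_mem_erase hj)]
  rw [prod_congr rfl this]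
  simp
  ring

/-- Both sides sum over a tuple and one extra draw; exchanging that draw with coordinate `i` matches
the terms, since `F` ignores this coordinate. Taking `β = b i` gives independence, and `G = 1` shows
that the law of an ignored coordinate is irrelevant. -/
lemma sum_piWeight_swap (b : ι → Ω → ℝ) (i : ι) (β : Ω → ℝ) {F : (ι → Ω) → ℝ} (G : Ω → ℝ)
    (hF : ∀ ω x, F (update ω i x) = F ω) :
    (∑ x, β x) * wmean (piWeight b) (fun ω => F ω * G (ω i)) =
      wmean (piWeight (update b i β)) F * wmean (b i) G := by
  have h1 : (∑ x, β x) * wmean (piWeight b) (fun ω => F ω * G (ω i)) =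
      ∑ q : (ι → Ω) × Ω, piWeight b q.1 * β q.2 * (F q.1 * G (q.1 i)) := by
    rw [Fintype.sum_prod_type, wmean, mul_sum]
    refine sum_congr rfl fun ω _ => ?_
    rw [sum_mul]
    exact sum_congr rfl fun x _ => by ring
  have h2 : wmean (piWeight (update b i β)) F * wmean (b i) G =
      ∑ q : (ι → Ω) × Ω, piWeight (update b i β) q.1 * b i q.2 * (F q.1 * G q.2) := by
    rw [Fintype.sum_prod_type, wmean, wmean, sum_mul]
    refine sum_congr rfl fun ω _ => ?_
    rw [mul_sum]
    exact sum_congr rfl fun x _ => by ring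
  rw [h1, h2]
  refine Fintype.sum_equiv (swapCoordinate i) _ _ fun q => ?_
  have := piWeight_update (update b i β) i (b i) q.1 q.2
  simp only [update_idem, update_eq_self, update_self] at this
  change _ = piWeight (update b i β) (update q.1 i q.2) * b i (q.1 i) *
    (F (update q.1 i q.2) * G (q.1 i))
  rw [hF, this]

lemma wmean_piWeight_mul_eval {b : ι → Ω → ℝ} {i : ι} {F : (ι → Ω) → ℝ} (G : Ω → ℝ)
    (hb : ∑ x, b i x = 1) (hF : ∀ ω x, F (update ω i x) = F ω) :
    wmean (piWeight b) (fun ω => F ω * G (ω i)) = wmean (piWeight b) F * wmean (b i) G := by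
  have := sum_piWeight_swap b i (b i) G hF
  rwa [hb, one_mul, update_eq_self] at this

lemma wmean_piWeight_update {b : ι → Ω → ℝ} {i : ι} {F : (ι → Ω) → ℝ} {β : Ω → ℝ}
    (hb : ∑ x, b i x = 1) (hβ : ∑ x, β x = 1) (hF : ∀ ω x, F (update ω i x) = F ω) :
    wmean (piWeight (update b i β)) F = wmean (piWeight b) F := by
  have := sum_piWeight_swap b i β (fun _ => 1) hF
  simp only [hβ, wmean, mul_one, hb, one_mul] at this
  exact this.symm

lemma wmean_piWeight_eval {b : ι → Ω → ℝ} (hb : ∀ i, b i ∈ stdSimplex ℝ Ω) (i : ι) (G : Ω → ℝ) :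
    wmean (piWeight b) (fun ω => G (ω i)) = wmean (b i) G := by
  have := wmean_piWeight_mul_eval (b := b) (i := i) (F := fun _ => 1) G (hb i).2 fun _ _ => rfl
  simpa [wmean_const (piWeight_mem_stdSimplex hb)] using this

/-- Replacing independent draws from `μ ≤ Λ ν` by draws from `ν`, for a function of the coordinates
in `J`. -/
lemma wmean_piWeight_le_pow {μ ν : Ω → ℝ} (hμ : μ ∈ stdSimplex ℝ Ω) (hν : ν ∈ stdSimplex ℝ Ω)
    {Λ : ℝ} (hΛ : 0 ≤ Λ) (h : ∀ x, μ x ≤ Λ * ν x) (J : Finset ι) {F : (ι → Ω) → ℝ}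
    (hF : ∀ ω, 0 ≤ F ω) (hJ : ∀ i ∉ J, ∀ ω x, F (update ω i x) = F ω) :
    wmean (piWeight fun _ => μ) F ≤ Λ ^ #J * wmean (piWeight fun _ => ν) F := by
  classical
  -- Hybrid argument: coordinates change law one at a time, and only those in `J` cost a factor `Λ`.
  have key : ∀ A : Finset ι, wmean (piWeight fun _ => μ) F ≤
      Λ ^ #(A ∩ J) * wmean (piWeight fun i => if i ∈ A then ν else μ) F := by
    intro A
    induction A using Finset.induction_on with
    | empty => simp
    | insert a A ha ih =>
      set b : ι → Ω → ℝ := fun i => if i ∈ A then ν else μ with hb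
      have hbu : (fun i => if i ∈ insert a A then ν else μ) = update b a ν := by
        funext i
        by_cases hi : i = a
        · subst hi; simp
        · simp [hi, hb]
      have hba : b a = μ := by simp [hb, ha]
      have hb0 : ∀ i x, 0 ≤ b i x := fun i x => by
        simp only [hb]; split_ifs
        exacts [hν.1 x, hμ.1 x]
      rw [hbu]
      refine ih.trans ?_
      by_cases haJ : a ∈ J
      · have hcard : #(insert a A ∩ J) = #(A ∩ J) + 1 := by
          rw [insert_inter_of_mem haJ, card_insert_of_notMem (by simp [ha])]
        rw [hcard, pow_succ, mul_assoc]
        refine mul_le_mul_of_nonneg_left ?_ (pow_nonneg hΛ _)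
        rw [← wmean_const_mul]
        refine sum_le_sum fun ω _ => ?_
        have h1 : piWeight b ω ≤ Λ * piWeight (update b a ν) ω := by
          rw [piWeight, piWeight, ← mul_prod_erase univ _ (mem_univ a),
            ← mul_prod_erase univ (fun i => update b a ν i (ω i)) (mem_univ a), ← mul_assoc]
          have : ∀ j ∈ univ.erase a, b j (ω j) = update b a ν j (ω j) := by
            intro j hj
            rw [update_of_ne (ne_of_mem_erase hj)]
          rw [prod_congr rfl this]
          refine mul_le_mul_of_nonneg_right ?_ ?_
          · simp only [hba, update_self]; exact h _
          · rw [← prod_congr rfl this]; exact prod_nonneg fun j _ => hb0 _ _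
        calc _ ≤ Λ * piWeight (update b a ν) ω * F ω :=
              mul_le_mul_of_nonneg_right h1 (hF ω)
          _ = _ := by ring
      · rw [insert_inter_of_notMem haJ, wmean_piWeight_update (by rw [hba]; exact hμ.2) hν.2
          (hJ a haJ)]
  have := key univ
  simpa using this

/-- Second and fourth moments of a weighted sum of independent centred draws. -/
lemma moments_weighted_sum {μ : Ω → ℝ} (hμ : μ ∈ stdSimplex ℝ Ω) {y : Ω → ℝ}
    (hy : wmean μ y = 0) (c : ι → ℝ) (s : Finset ι) :
    wmean (piWeight fun _ => μ) (fun ω => ∑ i ∈ s, c i * y (ω i)) = 0 ∧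
    wmean (piWeight fun _ => μ) (fun ω => (∑ i ∈ s, c i * y (ω i)) ^ 2) =
      wmean μ (fun x => y x ^ 2) * ∑ i ∈ s, c i ^ 2 ∧
    (wmean μ (fun x => y x ^ 4) ≤ 5 * wmean μ (fun x => y x ^ 2) ^ 2 →
      wmean (piWeight fun _ => μ) (fun ω => (∑ i ∈ s, c i * y (ω i)) ^ 4) ≤
        5 * (wmean μ (fun x => y x ^ 2) * ∑ i ∈ s, c i ^ 2) ^ 2) := by
  classical
  set v := wmean μ (fun x => y x ^ 2) with hv
  have hprod : (piWeight fun _ : ι => μ) ∈ stdSimplex ℝ (ι → Ω) :=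
    piWeight_mem_stdSimplex fun _ => hμ
  have hv0 : 0 ≤ v := wmean_nonneg hμ.1 fun x => by positivity
  induction s using Finset.induction_on with
  | empty => simp [wmean]
  | insert a s ha ih =>
    obtain ⟨h1, h2, h4⟩ := ih
    set Z : (ι → Ω) → ℝ := fun ω => ∑ i ∈ s, c i * y (ω i) with hZ
    have hinv : ∀ ω x, Z (update ω a x) = Z ω := by
      intro ω x
      refine sum_congr rfl fun i hi => ?_
      rw [update_of_ne (by rintro rfl; exact ha hi)]
    have split : ∀ (p q : ℕ), wmean (piWeight fun _ => μ) (fun ω => Z ω ^ p * y (ω a) ^ q) =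
        wmean (piWeight fun _ => μ) (fun ω => Z ω ^ p) * wmean μ (fun x => y x ^ q) :=
      fun p q => wmean_piWeight_mul_eval (b := fun _ => μ) (F := fun ω => Z ω ^ p)
        (fun x => y x ^ q) hμ.2 fun ω x => by simp only [hinv]
    have hins : ∀ ω, ∑ i ∈ insert a s, c i * y (ω i) = c a * y (ω a) + Z ω :=
      fun ω => sum_insert ha
    have e01 := split 0 1
    have e02 := split 0 2
    have e04 := split 0 4
    have e11 := split 1 1
    have e31 := split 3 1
    have e22 := split 2 2
    have e13 := split 1 3
    simp only [pow_zero, pow_one, one_mul, wmean_const hprod, hy, mul_zero, h1, zero_mul,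
      ← hv] at e01 e02 e04 e11 e31 e22 e13
    have h2Z : wmean (piWeight fun _ => μ) (fun ω => Z ω ^ 2) = v * ∑ i ∈ s, c i ^ 2 := h2
    rw [h2Z] at e22
    simp only [hins, sum_insert ha]
    refine ⟨?_, ?_, ?_⟩
    · rw [wmean_add, wmean_const_mul, e01, h1]; ring
    · have : (fun ω : ι → Ω => (c a * y (ω a) + Z ω) ^ 2) = fun ω =>
          c a ^ 2 * y (ω a) ^ 2 + (2 * c a * (Z ω * y (ω a)) + Z ω ^ 2) := by
        funext ω; ring
      rw [this, wmean_add, wmean_add, wmean_const_mul, wmean_const_mul, e02, e11, h2Z]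
      ring
    · intro hy4
      have : (fun ω : ι → Ω => (c a * y (ω a) + Z ω) ^ 4) = fun ω =>
          c a ^ 4 * y (ω a) ^ 4 + (4 * c a ^ 3 * (Z ω * y (ω a) ^ 3) +
            (6 * c a ^ 2 * (Z ω ^ 2 * y (ω a) ^ 2) + (4 * c a * (Z ω ^ 3 * y (ω a)) + Z ω ^ 4))) := by
        funext ω; ring
      rw [this, wmean_add, wmean_add, wmean_add, wmean_add, wmean_const_mul, wmean_const_mul,
        wmean_const_mul, wmean_const_mul, e04, e13, e22, e31]
      -- The odd cross terms vanish. The constant 5 propagates because the mixed term has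
      -- coefficient 6, below the 10 in the expansion of `5 (a + b) ^ 2`.
      have hs : 0 ≤ ∑ i ∈ s, c i ^ 2 := sum_nonneg fun i _ => sq_nonneg _
      have : wmean (piWeight fun _ => μ) (fun ω => Z ω ^ 4) ≤ _ := h4 hy4
      have := mul_le_mul_of_nonneg_left hy4 (by positivity : 0 ≤ c a ^ 4)
      have : 0 ≤ c a ^ 2 * v * (v * ∑ i ∈ s, c i ^ 2) := by positivity
      nlinarith

/-- A centred variable with fourth moment comparable to its variance is often non-positive. -/
lemma wprob_nonpos_ge {μ : Ω → ℝ} (hμ : μ ∈ stdSimplex ℝ Ω) {Z : Ω → ℝ} {V : ℝ} (hV : 0 < V)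
    (h1 : wmean μ Z = 0) (h2 : wmean μ (fun x => Z x ^ 2) = V)
    (h4 : wmean μ (fun x => Z x ^ 4) ≤ 5 * V ^ 2) : 1 / 21 ≤ wprob μ (fun x => Z x ≤ 0) := by
  classical
  set σ := √V with hσ
  have hσ0 : 0 < σ := Real.sqrt_pos.2 hV
  have hσ2 : σ ^ 2 = V := Real.sq_sqrt hV.le
  -- A quartic minorant of the indicator: with `z = Z / σ`, `(-6z + 6z² - z⁴) / 21` is at most 1 for
  -- `z ≤ 0` and at most 0 for `z > 0`. Its mean is at least `(6 - 5) / 21`.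
  have key : wmean μ (fun x => -(6 / (21 * σ)) * Z x + (6 / (21 * V) * Z x ^ 2 +
      -(1 / (21 * V ^ 2)) * Z x ^ 4)) ≤ wprob μ (fun x => Z x ≤ 0) := by
    rw [wprob_eq_wmean]
    refine wmean_mono hμ.1 fun x => ?_
    obtain ⟨z, hz⟩ : ∃ z, Z x = σ * z := ⟨Z x / σ, by field_simp⟩
    have e : -(6 / (21 * σ)) * Z x + (6 / (21 * V) * Z x ^ 2 + -(1 / (21 * V ^ 2)) * Z x ^ 4) =
        (-6 * z + 6 * z ^ 2 - z ^ 4) / 21 := by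
      rw [hz, ← hσ2]; field_simp; ring
    rw [e, hz]
    split_ifs with h
    · nlinarith [sq_nonneg (z ^ 2 - 4), sq_nonneg (z + 2), sq_nonneg (z ^ 2 - 3.8),
        sq_nonneg (z + 1.95)]
    · push Not at h
      have hz0 : 0 < z := pos_of_mul_pos_right h hσ0.le
      have : 0 ≤ z ^ 3 - 6 * z + 6 := by
        nlinarith [mul_nonneg hz0.le (sq_nonneg (z - 1.4)), sq_nonneg (z - 1.4)]
      nlinarith
  rw [wmean_add, wmean_add, wmean_const_mul, wmean_const_mul, wmean_const_mul, h1, h2] at key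
  have : 1 / (21 * V ^ 2) * wmean μ (fun x => Z x ^ 4) ≤ 5 / 21 := by
    calc _ ≤ 1 / (21 * V ^ 2) * (5 * V ^ 2) := mul_le_mul_of_nonneg_left h4 (by positivity)
      _ = _ := by field_simp
  have e2 : 6 / (21 * V) * V = 6 / 21 := by field_simp
  rw [e2] at key
  linarith

end WeightedSums

/-! ### Biased labels: anti-concentration and exponential moments. -/

section Coins

/-- The law of a random label of mean `μ`. -/
noncomputable def coin (μ : ℝ) (a : Label) : ℝ := (1 + μ * a.toReal) / 2

@[simp] lemma Label.toReal_one : Label.toReal 1 = 1 := by simp [Label.toReal]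

@[simp] lemma Label.toReal_neg_one : Label.toReal (-1) = -1 := by simp [Label.toReal]

lemma sum_label (F : Label → ℝ) : ∑ a, F a = F 1 + F (-1) := by
  have : (univ : Finset Label) = {1, -1} := by decide
  rw [this, sum_pair (by decide)]

lemma wmean_coin (μ : ℝ) (F : Label → ℝ) :
    wmean (coin μ) F = (1 + μ) / 2 * F 1 + (1 - μ) / 2 * F (-1) := by
  rw [wmean, sum_label]
  simp only [coin, Label.toReal_one, Label.toReal_neg_one]
  ring

lemma coin_mem_stdSimplex {μ : ℝ} (h : |μ| ≤ 1) : coin μ ∈ stdSimplex ℝ Label := by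
  rw [abs_le] at h
  refine ⟨fun a => ?_, ?_⟩
  · rcases Int.units_eq_one_or a with rfl | rfl <;> simp [coin] <;> linarith
  · rw [sum_label]; simp [coin]; ring

lemma wmean_coin_centred (μ : ℝ) : wmean (coin μ) (fun a => a.toReal - μ) = 0 := by
  rw [wmean_coin]; simp; ring

lemma wmean_coin_variance (μ : ℝ) :
    wmean (coin μ) (fun a => (a.toReal - μ) ^ 2) = 1 - μ ^ 2 := by
  rw [wmean_coin]; simp; ring

lemma wmean_coin_fourth (μ : ℝ) :
    wmean (coin μ) (fun a => (a.toReal - μ) ^ 4) = (1 - μ ^ 2) * (1 + 3 * μ ^ 2) := by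
  rw [wmean_coin]; simp; ring

/-- For `μ² ≤ 1/4` the fourth central moment of a coin is at most 5 times its squared variance, and
weighted sums inherit this. The bound is uniform in the weights, as the repeated entries of tuples
require. -/
lemma wprob_weighted_coins_ge {ι : Type*} [Fintype ι] [DecidableEq ι] {μ : ℝ} (h : |μ| ≤ 1 / 2)
    {c : ι → ℝ} (hc : ∃ i, c i ≠ 0) :
    1 / 21 ≤ wprob (piWeight fun _ : ι => coin μ)
      (fun ξ => ∑ i, c i * (ξ i).toReal ≤ μ * ∑ i, c i) := by
  have hμ2 : μ ^ 2 ≤ 1 / 4 := by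
    have := sq_le_sq' (abs_le.1 h).1 (abs_le.1 h).2
    linarith
  have hcoin := coin_mem_stdSimplex (h.trans (by norm_num))
  obtain ⟨h1, h2, h4⟩ := moments_weighted_sum hcoin (wmean_coin_centred μ) c univ
  rw [wmean_coin_variance, wmean_coin_fourth] at h4
  rw [wmean_coin_variance] at h2
  obtain ⟨i, hi⟩ := hc
  have hcs : 0 < ∑ i, c i ^ 2 :=
    sum_pos' (fun i _ => sq_nonneg _) ⟨i, mem_univ _, by positivity⟩
  have := wprob_nonpos_ge (piWeight_mem_stdSimplex fun _ : ι => hcoin)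
    (mul_pos (by linarith) hcs) h1 h2 (h4 (by nlinarith [sq_nonneg μ]))
  refine this.trans (wprob_mono (piWeight_nonneg fun _ => hcoin.1) fun ξ hξ => ?_)
  simp only [mul_sub, sum_sub_distrib, ← sum_mul] at hξ
  linarith

/-- Chernoff factor for falling below half the mean: to second order the untilted part is at most `1
+ γ² - 4γ²`, and the shift contributes `2γ²`. The next lemma is the analogue for mean `-4γ` and
threshold `-6γ`. -/
lemma wmean_coin_exp_le {γ : ℝ} (h0 : 0 < γ) (h1 : γ ≤ 1 / 4) :
    wmean (coin (4 * γ)) (fun a => Real.exp (-γ * (a.toReal - 2 * γ))) ≤ Real.exp (-γ ^ 2) := by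
  have e1 := (abs_le.1 (Real.abs_exp_sub_one_sub_id_le (x := -γ)
    (by rw [abs_neg, abs_of_pos h0]; linarith))).2
  have e2 := (abs_le.1 (Real.abs_exp_sub_one_sub_id_le (x := γ)
    (by rw [abs_of_pos h0]; linarith))).2
  have e3 := Real.add_one_le_exp (-3 * γ ^ 2)
  have : ∀ a : ℝ, Real.exp (-γ * (a - 2 * γ)) = Real.exp (2 * γ ^ 2) * Real.exp (-γ * a) := by
    intro a
    rw [← Real.exp_add]; congr 1; ring
  simp only [this]
  rw [wmean_const_mul, wmean_coin]
  have : Real.exp (-γ ^ 2) = Real.exp (2 * γ ^ 2) * Real.exp (-3 * γ ^ 2) := by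
    rw [← Real.exp_add]; congr 1; ring
  rw [this]
  refine mul_le_mul_of_nonneg_left ?_ (Real.exp_nonneg _)
  simp only [Label.toReal_one, Label.toReal_neg_one]
  rw [mul_one, neg_mul_neg, mul_one]
  nlinarith

lemma wmean_neg_coin_exp_le {γ : ℝ} (h0 : 0 < γ) (h1 : γ ≤ 1 / 4) :
    wmean (coin (-(4 * γ))) (fun a => Real.exp (-γ * (a.toReal - -6 * γ))) ≤
      Real.exp (-γ ^ 2) := by
  have e1 := (abs_le.1 (Real.abs_exp_sub_one_sub_id_le (x := -γ)
    (by rw [abs_neg, abs_of_pos h0]; linarith))).2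
  have e2 := (abs_le.1 (Real.abs_exp_sub_one_sub_id_le (x := γ)
    (by rw [abs_of_pos h0]; linarith))).2
  have e3 := Real.add_one_le_exp (5 * γ ^ 2)
  have : ∀ a : ℝ, Real.exp (-γ * (a - -6 * γ)) = Real.exp (-6 * γ ^ 2) * Real.exp (-γ * a) := by
    intro a
    rw [← Real.exp_add]; congr 1; ring
  simp only [this]
  rw [wmean_const_mul, wmean_coin]
  have : Real.exp (-γ ^ 2) = Real.exp (-6 * γ ^ 2) * Real.exp (5 * γ ^ 2) := by
    rw [← Real.exp_add]; congr 1; ring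
  rw [this]
  refine mul_le_mul_of_nonneg_left ?_ (Real.exp_nonneg _)
  simp only [Label.toReal_one, Label.toReal_neg_one]
  rw [mul_one, neg_mul_neg, mul_one]
  nlinarith

end Coins

/-! ### The biased laws, their slices and conditioning. -/

section Laws

variable {X : Type} [Fintype X] [DecidableEq X]

/-- The law of a hypothesis with independent values, of mean `-4 γ` on `T` and `4 γ` elsewhere. -/
noncomputable def lawOn (γ : ℝ) (T : Finset X) : Hypothesis X → ℝ :=
  piWeight fun x => coin (if x ∈ T then -(4 * γ) else 4 * γ)

omit [Fintype X] in
lemma coin_ite_mem {γ : ℝ} (h0 : 0 < γ) (h1 : γ ≤ 1 / 100) (T : Finset X) (x : X) :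
    coin (if x ∈ T then -(4 * γ) else 4 * γ) ∈ stdSimplex ℝ Label := by
  refine coin_mem_stdSimplex ?_
  split_ifs <;> rw [abs_le] <;> constructor <;> linarith

lemma lawOn_mem_stdSimplex {γ : ℝ} (h0 : 0 < γ) (h1 : γ ≤ 1 / 100) (T : Finset X) :
    lawOn γ T ∈ stdSimplex ℝ (Hypothesis X) :=
  piWeight_mem_stdSimplex fun x => coin_ite_mem h0 h1 T x

/-- The sum of the labels of `h` on `T`. -/
def labelSum (T : Finset X) (h : Hypothesis X) : ℤ := ∑ x ∈ T, ((h x : ℤˣ) : ℤ)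

omit [Fintype X] [DecidableEq X] in
lemma labelSum_cast (T : Finset X) (h : Hypothesis X) :
    ((labelSum T h : ℤ) : ℝ) = ∑ x ∈ T, (h x).toReal := by
  simp [labelSum, Label.toReal]

omit [Fintype X] [DecidableEq X] in
lemma labelSum_mem_Icc (T : Finset X) (h : Hypothesis X) :
    labelSum T h ∈ Icc (-(#T : ℤ)) (#T : ℤ) := by
  have hb : ∀ x ∈ T, |((h x : ℤˣ) : ℤ)| ≤ 1 := fun x _ => by
    rcases Int.units_eq_one_or (h x) with hx | hx <;> simp [hx]
  have := (abs_sum_le_sum_abs _ _).trans (sum_le_sum hb)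
  rw [sum_const, nsmul_eq_mul, mul_one, abs_le] at this
  exact mem_Icc.2 this

lemma wprob_labelSum_ge {γ : ℝ} (h0 : 0 < γ) (h1 : γ ≤ 1 / 100) (T : Finset X)
    (hT : 1 ≤ γ ^ 2 * #T) :
    1 / 2 ≤ wprob (lawOn γ T) (fun h => -(6 * γ * #T) ≤ (labelSum T h : ℝ)) := by
  have hlaw := lawOn_mem_stdSimplex h0 h1 T
  have hcompl := wprob_add_not hlaw fun h => -(6 * γ * #T) ≤ (labelSum T h : ℝ)
  suffices h : wprob (lawOn γ T) (fun h => ¬ -(6 * γ * #T) ≤ (labelSum T h : ℝ)) ≤ 1 / 2 by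
    linarith
  set F : X → Label → ℝ := fun x a =>
    if x ∈ T then Real.exp (-γ * (a.toReal - -6 * γ)) else 1 with hF
  have hF0 : ∀ x a, 0 ≤ F x a := fun x a => by simp only [hF]; split_ifs <;> positivity
  have hmean : wmean (lawOn γ T) (fun h => ∏ x, F x (h x)) ≤ 1 / 2 := by
    rw [lawOn, wmean_piWeight_prod]
    have hx : ∀ x ∈ univ, wmean (coin (if x ∈ T then -(4 * γ) else 4 * γ)) (F x) ≤
        if x ∈ T then Real.exp (-γ ^ 2) else 1 := by
      intro x _
      have hmem := coin_ite_mem h0 h1 T x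
      by_cases hx : x ∈ T
      · simp only [hx, if_true, hF]
        exact wmean_neg_coin_exp_le h0 (by linarith)
      · simp only [hx, if_false, hF] at hmem ⊢
        rw [wmean_const hmem]
    refine (prod_le_prod (fun x _ => ?_) hx).trans ?_
    · exact wmean_nonneg (coin_ite_mem h0 h1 T x).1 (hF0 x)
    · rw [prod_ite_mem, univ_inter, prod_const, ← Real.exp_nat_mul]
      calc Real.exp (#T * -γ ^ 2) ≤ Real.exp (-1) := Real.exp_le_exp.2 (by linarith)
        _ ≤ 1 / 2 := by
          rw [Real.exp_neg, one_div]
          exact inv_anti₀ (by norm_num) (by linarith [Real.add_one_le_exp (1 : ℝ)])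
  refine (wprob_le_wmean hlaw.1 (fun h => prod_nonneg fun x _ => hF0 x _) fun h hh => ?_).trans hmean
  simp only [hF]
  rw [prod_ite_mem, univ_inter, ← Real.exp_sum, ← mul_sum, sum_sub_distrib, sum_const,
    ← labelSum_cast, nsmul_eq_mul]
  refine Real.one_le_exp ?_
  push Not at hh
  nlinarith

/-- Pigeonhole: mass at least 1/2 is shared by at most `2 * #T + 1` integer values. -/
lemma exists_heavy_slice {γ : ℝ} (h0 : 0 < γ) (h1 : γ ≤ 1 / 100) (T : Finset X)
    (hT : 1 ≤ γ ^ 2 * #T) :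
    ∃ s : ℤ, -(6 * γ * #T) ≤ (s : ℝ) ∧
      1 / (4 * #T + 2 : ℝ) ≤ wprob (lawOn γ T) (fun h => labelSum T h = s) := by
  classical
  have hlaw := lawOn_mem_stdSimplex h0 h1 T
  have hhalf := wprob_labelSum_ge h0 h1 T hT
  set A : Finset ℤ := (Icc (-(#T : ℤ)) (#T : ℤ)).filter fun s : ℤ => -(6 * γ * #T) ≤ (s : ℝ) with hA
  have hle : 1 / 2 ≤ ∑ s ∈ A, wprob (lawOn γ T) (fun h => labelSum T h = s) := by
    refine hhalf.trans ((wprob_mono hlaw.1 fun h hh => ?_).trans (wprob_exists_le A hlaw.1 _))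
    exact ⟨labelSum T h, mem_filter.2 ⟨labelSum_mem_Icc T h, hh⟩, rfl⟩
  by_contra! hc
  have hne : A.Nonempty := by
    rw [nonempty_iff_ne_empty]
    intro h
    rw [h, sum_empty] at hle
    norm_num at hle
  have hlt := sum_lt_sum_of_nonempty hne fun s hs => hc s (mem_filter.1 hs).2
  have hcard : (#A : ℝ) ≤ 2 * #T + 1 := by
    have := card_filter_le (Icc (-(#T : ℤ)) (#T : ℤ)) fun s : ℤ => -(6 * γ * #T) ≤ (s : ℝ)
    rw [Int.card_Icc] at this
    have h2 : #A ≤ 2 * #T + 1 := by rw [hA]; omega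
    exact_mod_cast h2
  rw [sum_const, nsmul_eq_mul] at hlt
  have : (#A : ℝ) * (1 / (4 * #T + 2)) ≤ 1 / 2 := by
    rw [mul_one_div, div_le_div_iff₀ (by positivity) (by norm_num)]
    linarith
  linarith

/-- Flipping the bias at a point of `T` multiplies the weight by the same ratio, or its inverse,
according to the label. The likelihood ratio thus depends on `h` only through `labelSum T h`, and
conditioning on that sum erases the difference between the laws. -/
lemma lawOn_empty_eq {γ : ℝ} (h0 : 0 < γ) (h1 : γ ≤ 1 / 100) (T : Finset X) (h : Hypothesis X) :
    lawOn γ ∅ h = ((1 + 4 * γ) / (1 - 4 * γ)) ^ labelSum T h * lawOn γ T h := by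
  have hq : (0 : ℝ) < (1 + 4 * γ) / (1 - 4 * γ) := div_pos (by linarith) (by linarith)
  have hz : ((1 + 4 * γ) / (1 - 4 * γ)) ^ labelSum T h =
      ∏ x, if x ∈ T then ((1 + 4 * γ) / (1 - 4 * γ)) ^ ((h x : ℤˣ) : ℤ) else 1 := by
    rw [labelSum, prod_ite_mem, univ_inter]
    induction T using Finset.induction_on with
    | empty => simp
    | insert a s ha ih => rw [sum_insert ha, prod_insert ha, zpow_add₀ hq.ne', ih]
  rw [hz, lawOn, lawOn, piWeight, piWeight, ← prod_mul_distrib]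
  refine prod_congr rfl fun x _ => ?_
  have : 1 - 4 * γ ≠ 0 := by linarith
  have : 1 + 4 * γ ≠ 0 := by linarith
  by_cases hx : x ∈ T
  · rcases Int.units_eq_one_or (h x) with hh | hh <;> simp [hx, hh, coin] <;> field_simp <;> ring
  · simp [hx]

lemma slice_ratio_ge {γ : ℝ} (h0 : 0 < γ) (h1 : γ ≤ 1 / 100) {t : ℝ} {s : ℤ} (ht : 0 ≤ t)
    (hs : -(6 * γ * t) ≤ (s : ℝ)) :
    Real.exp (-(54 * γ ^ 2 * t)) ≤ ((1 + 4 * γ) / (1 - 4 * γ)) ^ s := by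
  have hq1 : 1 ≤ (1 + 4 * γ) / (1 - 4 * γ) := by rw [le_div_iff₀ (by linarith)]; linarith
  have hq : (0 : ℝ) < (1 + 4 * γ) / (1 - 4 * γ) := by linarith
  have hlog : Real.log ((1 + 4 * γ) / (1 - 4 * γ)) ≤ 9 * γ := by
    rw [Real.log_le_iff_le_exp hq]
    refine le_trans ?_ (Real.add_one_le_exp _)
    rw [div_le_iff₀ (by linarith)]
    nlinarith
  have hlog0 := Real.log_nonneg hq1
  rw [← Real.rpow_intCast, Real.rpow_def_of_pos hq]
  refine Real.exp_le_exp.2 ?_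
  have : 0 ≤ γ * t := by positivity
  nlinarith

/-- The weights `μ` conditioned on the event `E`. -/
noncomputable def condWeight {Ω : Type*} [Fintype Ω] (μ : Ω → ℝ) (E : Ω → Prop) (x : Ω) : ℝ :=
  open Classical in if E x then μ x / wprob μ E else 0

lemma condWeight_mem_stdSimplex {Ω : Type*} [Fintype Ω] {μ : Ω → ℝ} (hμ : ∀ x, 0 ≤ μ x)
    {E : Ω → Prop} (hE : 0 < wprob μ E) : condWeight μ E ∈ stdSimplex ℝ Ω := by
  classical
  refine ⟨fun x => ?_, ?_⟩
  · rw [condWeight]; split_ifs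
    exacts [div_nonneg (hμ x) hE.le, le_rfl]
  · simp only [condWeight, ← sum_filter, ← sum_div]
    exact div_self hE.ne'

/-- The conditioning event involves only labels on `T`, which are independent of the label at `x`.
-/
lemma wmean_condWeight_eval {γ : ℝ} (h0 : 0 < γ) (h1 : γ ≤ 1 / 100) {T : Finset X} {s : ℤ}
    (hE : 0 < wprob (lawOn γ T) (fun h => labelSum T h = s)) {x : X} (hx : x ∉ T)
    (G : Label → ℝ) :
    wmean (condWeight (lawOn γ T) fun h => labelSum T h = s) (fun h => G (h x)) =
      wmean (coin (4 * γ)) G := by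
  classical
  have hinv : ∀ (h : Hypothesis X) a, labelSum T (update h x a) = labelSum T h := by
    intro h a
    refine sum_congr rfl fun y hy => ?_
    rw [update_of_ne (by rintro rfl; exact hx hy)]
  have := wmean_piWeight_mul_eval (b := fun x => coin (if x ∈ T then -(4 * γ) else 4 * γ))
    (i := x) (F := fun h : Hypothesis X => if labelSum T h = s then 1 else 0) G
    (coin_ite_mem h0 h1 T x).2 fun h a => by rw [hinv]
  change wmean (lawOn γ T) _ = wmean (lawOn γ T) _ * _ at this
  rw [← wprob_eq_wmean, if_neg hx] at this
  rw [← mul_right_inj' hE.ne', ← this, ← wmean_const_mul]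
  refine sum_congr rfl fun h _ => ?_
  by_cases hh : labelSum T h = s <;> simp [condWeight, hh]
  field_simp

/-- Exchanging the order of independent coordinates. -/
lemma wmean_piWeight_swap {ι : Type*} [Fintype ι] [DecidableEq ι] (b : X → Label → ℝ)
    (ψ : X → (ι → Label) → ℝ) :
    wmean (piWeight fun _ : ι => piWeight b) (fun g => ∏ x, ψ x fun i => g i x) =
      ∏ x, wmean (piWeight fun _ : ι => b x) (ψ x) := by
  rw [← wmean_piWeight_prod]
  refine Fintype.sum_equiv (Equiv.piComm fun _ _ => Label) _ _ fun g => ?_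
  simp only [piWeight]
  rw [prod_comm]
  rfl

/-- The adverse events at different points of `T` are independent, each of probability at least
1/21. Weighting each by 1/2 gives factors of mean at most `1 - 1/42`; Markov's inequality at level
`#T / 84` loses half of the exponent. -/
lemma wprob_few_negative_le {ι : Type*} [Fintype ι] [DecidableEq ι] {γ : ℝ} (h0 : 0 < γ)
    (h1 : γ ≤ 1 / 100) (T : Finset X) {c : ι → ℝ} (hc : ∃ i, c i ≠ 0) :
    wprob (piWeight fun _ : ι => lawOn γ T) (fun g =>
      (#{x ∈ T | ∑ i, c i * (g i x).toReal ≤ -(4 * γ) * ∑ i, c i} : ℝ) < #T / 84) ≤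
      Real.exp (-(#T / 84 : ℝ)) := by
  classical
  set p : (ι → Label) → Prop := fun ξ => ∑ i, c i * (ξ i).toReal ≤ -(4 * γ) * ∑ i, c i with hp
  set ψ : X → (ι → Label) → ℝ := fun x ξ => if x ∈ T then (if p ξ then 1 / 2 else 1) else 1
    with hψ
  have hψx : ∀ x, wmean (piWeight fun _ : ι => coin (if x ∈ T then -(4 * γ) else 4 * γ)) (ψ x) ≤
      if x ∈ T then Real.exp (-1 / 42) else 1 := by
    intro x
    have hmem := piWeight_mem_stdSimplex fun _ : ι => coin_ite_mem h0 h1 T x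
    by_cases hx : x ∈ T
    · simp only [hx, if_true, hψ] at hmem ⊢
      have h21 := wprob_weighted_coins_ge (μ := -(4 * γ))
        (by rw [abs_neg, abs_of_pos (by linarith)]; linarith) hc
      have e : (fun ξ => if p ξ then (1 / 2 : ℝ) else 1) =
          fun ξ => 1 + (-1 / 2) * (if p ξ then (1 : ℝ) else 0) := by
        funext ξ; split_ifs <;> norm_num
      rw [e, wmean_add, wmean_const_mul, wmean_const hmem, ← wprob_eq_wmean]
      have := Real.add_one_le_exp (-1 / 42)
      linarith
    · simp only [hx, if_false, hψ] at hmem ⊢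
      rw [wmean_const hmem]
  have hmean : wmean (piWeight fun _ : ι => lawOn γ T) (fun g => ∏ x, ψ x fun i => g i x) ≤
      Real.exp (-(#T / 42 : ℝ)) := by
    rw [lawOn, wmean_piWeight_swap]
    refine (prod_le_prod (fun x _ => ?_) fun x _ => hψx x).trans ?_
    · refine wmean_nonneg (piWeight_nonneg fun _ => (coin_ite_mem h0 h1 T x).1) fun ξ => ?_
      simp only [hψ]; split_ifs <;> norm_num
    · rw [prod_ite_mem, univ_inter, prod_const, ← Real.exp_nat_mul]
      exact Real.exp_le_exp.2 (by linarith)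
  have hnn : ∀ g : ι → Hypothesis X, 0 ≤ piWeight (fun _ : ι => lawOn γ T) g :=
    piWeight_nonneg fun _ => (lawOn_mem_stdSimplex h0 h1 T).1
  have hmarkov : wprob (piWeight fun _ : ι => lawOn γ T) (fun g =>
      (#{x ∈ T | ∑ i, c i * (g i x).toReal ≤ -(4 * γ) * ∑ i, c i} : ℝ) < #T / 84) ≤
      wmean (piWeight fun _ : ι => lawOn γ T)
        (fun g => Real.exp (#T / 84) * ∏ x, ψ x fun i => g i x) := by
    refine wprob_le_wmean hnn (fun g => mul_nonneg (Real.exp_nonneg _) (prod_nonneg fun x _ => ?_))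
      fun g hg => ?_
    · simp only [hψ]; split_ifs <;> norm_num
    · have hprod : ∏ x, ψ x (fun i => g i x) =
          (1 / 2) ^ #{x ∈ T | ∑ i, c i * (g i x).toReal ≤ -(4 * γ) * ∑ i, c i} := by
        simp only [hψ]
        rw [prod_ite_mem, univ_inter, prod_ite, prod_const, prod_const, one_pow, mul_one]
      rw [hprod]
      set N := #{x ∈ T | ∑ i, c i * (g i x).toReal ≤ -(4 * γ) * ∑ i, c i}
      have h2 : Real.exp (-(N : ℝ)) ≤ (1 / 2) ^ N := by
        have : Real.exp (-1) ≤ 1 / 2 := by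
          rw [Real.exp_neg, one_div]
          exact inv_anti₀ (by norm_num) (by linarith [Real.add_one_le_exp (1 : ℝ)])
        calc Real.exp (-(N : ℝ)) = Real.exp (-1) ^ N := by
              rw [← Real.exp_nat_mul]; congr 1; ring
          _ ≤ _ := pow_le_pow_left₀ (Real.exp_nonneg _) this N
      calc (1 : ℝ) ≤ Real.exp (#T / 84) * Real.exp (-(N : ℝ)) := by
            rw [← Real.exp_add]; exact Real.one_le_exp (by linarith)
        _ ≤ _ := mul_le_mul_of_nonneg_left h2 (Real.exp_nonneg _)
  rw [wmean_const_mul] at hmarkov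
  refine hmarkov.trans ((mul_le_mul_of_nonneg_left hmean (Real.exp_nonneg _)).trans ?_)
  rw [← Real.exp_add]
  exact Real.exp_le_exp.2 (by linarith)

end Laws

/-! ### Trapping families and sparsification of votes. -/

section Families

variable {X : Type} [Fintype X] [DecidableEq X]

/-- A family of hypotheses whose average has margin `2 γ` outside `T`, while every average of `k`
of its members is at most `-4 γ` on a fraction `1/84` of `T`. -/
structure IsTrappingFamily (γ : ℝ) (T : Finset X) (k : ℕ) {n : ℕ} (g : Fin n → Hypothesis X) :
    Prop where
  margin : ∀ x ∉ T, 2 * γ * n ≤ ∑ j, (g j x).toReal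
  adverse : ∀ j : Fin k → Fin n,
    (#T / 84 : ℝ) ≤ #{x ∈ T | ∑ a, (g (j a) x).toReal ≤ -(4 * γ) * k}

omit [Fintype X] [DecidableEq X] in
/-- Some tuple drawn from the weights `w` approximates the weighted vote on most of `T`. -/
lemma exists_sparse_vote {N : ℕ} {w : Fin N → ℝ} (hw : w ∈ stdSimplex ℝ (Fin N))
    (h : Fin N → Hypothesis X) (T : Finset X) {γ : ℝ} (h0 : 0 < γ) {k : ℕ}
    (hk : 42 ≤ k * γ ^ 2) :
    ∃ J : Fin k → Fin N, (#{x ∈ T | 0 ≤ ∑ i, w i * (h i x).toReal ∧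
      ∑ a, (h (J a) x).toReal ≤ -(4 * γ) * k} : ℝ) ≤ #T / 168 := by
  classical
  have hk0 : (0 : ℝ) < k := pos_of_mul_pos_left (by linarith) (sq_nonneg γ)
  have hprod := piWeight_mem_stdSimplex fun _ : Fin k => hw
  -- Chebyshev: if the vote is non-negative, the sampled sum lies `4γk` below its mean, while its
  -- variance is at most `k`. The probability is at most `1 / (16γ²k)`, well below 1/168.
  have hx : ∀ x, wprob (piWeight fun _ : Fin k => w) (fun J => 0 ≤ ∑ i, w i * (h i x).toReal ∧
      ∑ a, (h (J a) x).toReal ≤ -(4 * γ) * k) ≤ 1 / 168 := by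
    intro x
    set f := ∑ i, w i * (h i x).toReal with hf
    set y : Fin N → ℝ := fun i => (h i x).toReal - f with hy
    have hy0 : wmean w y = 0 := by
      simp only [wmean, hy, mul_sub, sum_sub_distrib, ← sum_mul, hw.2]
      simp [hf]
    have hsq : ∀ i, (h i x).toReal ^ 2 = 1 := fun i => by
      rcases Int.units_eq_one_or (h i x) with hh | hh <;> simp [hh]
    have hv : wmean w (fun i => y i ^ 2) ≤ 1 := by
      have : wmean w (fun i => y i ^ 2) = 1 - f ^ 2 := by
        have e : (fun i => y i ^ 2) = fun i => (1 + f ^ 2) + (-2 * f) * (h i x).toReal := by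
          funext i
          simp only [hy]
          linear_combination hsq i
        rw [e, wmean_add, wmean_const_mul, wmean_const hw]
        have : wmean w (fun i => (h i x).toReal) = f := rfl
        rw [this]; ring
      linarith [sq_nonneg f]
    obtain ⟨-, h2, -⟩ := moments_weighted_sum hw hy0 (fun _ : Fin k => 1) univ
    simp only [one_mul, one_pow, sum_const, card_univ, Fintype.card_fin, nsmul_eq_mul, mul_one]
      at h2
    have hden : 0 < (4 * γ * k) ^ 2 := by positivity
    have := wprob_le_wmean hprod.1
      (F := fun J => ((4 * γ * k) ^ 2)⁻¹ * (∑ a, y (J a)) ^ 2) (fun J => by positivity)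
      (p := fun J => 0 ≤ f ∧ ∑ a, (h (J a) x).toReal ≤ -(4 * γ) * k) (fun J hJ => by
        rw [← div_eq_inv_mul, le_div_iff₀ hden, one_mul]
        have : ∑ a, y (J a) ≤ -(4 * γ * k) := by
          simp only [hy, sum_sub_distrib, sum_const, card_univ, Fintype.card_fin, nsmul_eq_mul]
          have := mul_nonneg hk0.le hJ.1
          linarith [hJ.2]
        have : 0 < 4 * γ * k := by positivity
        nlinarith)
    rw [wmean_const_mul, h2] at this
    refine this.trans ?_
    rw [← div_eq_inv_mul, div_le_div_iff₀ hden (by norm_num)]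
    nlinarith
  have hmean : wmean (piWeight fun _ : Fin k => w) (fun J => ∑ x ∈ T,
      if 0 ≤ ∑ i, w i * (h i x).toReal ∧ ∑ a, (h (J a) x).toReal ≤ -(4 * γ) * k
        then (1 : ℝ) else 0) ≤ #T / 168 := by
    rw [wmean_sum]
    simp only [← wprob_eq_wmean]
    refine (sum_le_sum fun x _ => hx x).trans ?_
    rw [sum_const, nsmul_eq_mul]
    linarith
  obtain ⟨J, hJ⟩ := exists_le_of_wmean_le hprod hmean
  refine ⟨J, ?_⟩
  rwa [sum_boole] at hJ

omit [Fintype X] in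
/-- Every weighted vote of a trapping family errs on a constant fraction of `T`. -/
lemma IsTrappingFamily.card_negative_ge {γ : ℝ} {T : Finset X} {k n : ℕ}
    {g : Fin n → Hypothesis X} (hg : IsTrappingFamily γ T k g) (h0 : 0 < γ)
    (hk : 42 ≤ k * γ ^ 2) {N : ℕ} {w : Fin N → ℝ} (hw : w ∈ stdSimplex ℝ (Fin N))
    (φ : Fin N → Fin n) :
    (#T / 168 : ℝ) ≤ #{x ∈ T | ∑ i, w i * (g (φ i) x).toReal < 0} := by
  classical
  obtain ⟨J, hJ⟩ := exists_sparse_vote hw (fun i => g (φ i)) T h0 hk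
  have h1 := hg.adverse fun a => φ (J a)
  have h2 : #{x ∈ T | ∑ a, (g (φ (J a)) x).toReal ≤ -(4 * γ) * k} ≤
      #{x ∈ T | 0 ≤ ∑ i, w i * (g (φ i) x).toReal ∧
        ∑ a, (g (φ (J a)) x).toReal ≤ -(4 * γ) * k} +
      #{x ∈ T | ∑ i, w i * (g (φ i) x).toReal < 0} := by
    refine (card_le_card fun x hx => ?_).trans (card_union_le _ _)
    simp only [mem_filter, mem_union] at hx ⊢
    rcases le_or_gt 0 (∑ i, w i * (g (φ i) x).toReal) with h | h
    · exact Or.inl ⟨hx.1, h, hx.2⟩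
    · exact Or.inr ⟨hx.1, h⟩
  have h3 : (#{x ∈ T | ∑ a, (g (φ (J a)) x).toReal ≤ -(4 * γ) * k} : ℝ) ≤
      #{x ∈ T | 0 ≤ ∑ i, w i * (g (φ i) x).toReal ∧
        ∑ a, (g (φ (J a)) x).toReal ≤ -(4 * γ) * k} +
      #{x ∈ T | ∑ i, w i * (g (φ i) x).toReal < 0} := by exact_mod_cast h2
  linarith

lemma wprob_small_margin_le {γ : ℝ} (h0 : 0 < γ) (h1 : γ ≤ 1 / 100) {T : Finset X} {s : ℤ}
    (hE : 0 < wprob (lawOn γ T) (fun h => labelSum T h = s)) {x : X} (hx : x ∉ T) (n : ℕ) :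
    wprob (piWeight fun _ : Fin n => condWeight (lawOn γ T) fun h => labelSum T h = s)
      (fun g => ∑ j, (g j x).toReal < 2 * γ * n) ≤ Real.exp (-(n * γ ^ 2)) := by
  have hμ := condWeight_mem_stdSimplex (lawOn_mem_stdSimplex h0 h1 T).1 hE
  refine (wprob_le_wmean (piWeight_nonneg fun _ => hμ.1)
    (F := fun g => ∏ j, Real.exp (-γ * ((g j x).toReal - 2 * γ)))
    (fun g => prod_nonneg fun j _ => Real.exp_nonneg _) fun g hg => ?_).trans ?_
  · rw [← Real.exp_sum, ← mul_sum, sum_sub_distrib, sum_const, card_univ, Fintype.card_fin,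
      nsmul_eq_mul]
    exact Real.one_le_exp (by nlinarith)
  · have := wmean_piWeight_prod (fun _ : Fin n => condWeight (lawOn γ T) fun h => labelSum T h = s)
      (fun _ h => Real.exp (-γ * ((h x).toReal - 2 * γ)))
    rw [this, prod_const, card_univ, Fintype.card_fin,
      wmean_condWeight_eval h0 h1 hE hx fun a => Real.exp (-γ * (a.toReal - 2 * γ))]
    refine (pow_le_pow_left₀ (wmean_nonneg (coin_mem_stdSimplex (by
      rw [abs_of_pos (by linarith)]; linarith)).1 fun a => Real.exp_nonneg _)
      (wmean_coin_exp_le h0 (by linarith)) n).trans ?_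
    rw [← Real.exp_nat_mul]
    exact Real.exp_le_exp.2 (by linarith)

lemma condWeight_le {Ω : Type*} [Fintype Ω] {Λ : ℝ} {μ : Ω → ℝ} (hμ : ∀ x, 0 ≤ μ x) (hΛ : 0 < Λ)
    {E : Ω → Prop} (hE : 1 / Λ ≤ wprob μ E) (x : Ω) : condWeight μ E x ≤ Λ * μ x := by
  have hE0 : 0 < wprob μ E := lt_of_lt_of_le (by positivity) hE
  rw [condWeight]
  split_ifs
  · rw [div_le_iff₀ hE0]
    rw [div_le_iff₀' hΛ] at hE
    nlinarith [hμ x]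
  · exact mul_nonneg hΛ.le (hμ x)

/-- The conditioned law has density at most `4 * #T + 2` against the independent one. The event
involves at most `k` draws, so the change of law costs at most the `k`-th power, not the `n`-th. -/
lemma wprob_not_adverse_le {γ : ℝ} (h0 : 0 < γ) (h1 : γ ≤ 1 / 100) {T : Finset X} {s : ℤ}
    (hE : 1 / (4 * #T + 2 : ℝ) ≤ wprob (lawOn γ T) (fun h => labelSum T h = s)) {n k : ℕ}
    (hk : 0 < k) (j : Fin k → Fin n) :
    wprob (piWeight fun _ : Fin n => condWeight (lawOn γ T) fun h => labelSum T h = s)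
      (fun g => (#{x ∈ T | ∑ a, (g (j a) x).toReal ≤ -(4 * γ) * k} : ℝ) < #T / 84) ≤
      (4 * #T + 2) ^ k * Real.exp (-(#T / 84 : ℝ)) := by
  classical
  have hlaw := lawOn_mem_stdSimplex h0 h1 T
  have hΛ : (0 : ℝ) < 4 * #T + 2 := by positivity
  have hE0 : 0 < wprob (lawOn γ T) (fun h => labelSum T h = s) :=
    lt_of_lt_of_le (by positivity) hE
  have hμ := condWeight_mem_stdSimplex hlaw.1 hE0
  rw [wprob_eq_wmean]
  have hcard : #(univ.image j) ≤ k := card_image_le.trans (by simp)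
  refine (wmean_piWeight_le_pow hμ hlaw hΛ.le
    (condWeight_le hlaw.1 hΛ hE) (univ.image j) (fun g => by positivity) ?_).trans ?_
  · intro i hi g h
    have : ∀ a, update g i h (j a) = g (j a) := fun a =>
      update_of_ne (by rintro rfl; exact hi (mem_image_of_mem j (mem_univ a))) _ _
    simp only [this]
  · rw [← wprob_eq_wmean]
    refine mul_le_mul (pow_le_pow_right₀ (by linarith [(Nat.cast_nonneg #T : (0 : ℝ) ≤ #T)]) hcard)
      ?_ (wprob_nonneg (piWeight_nonneg fun _ => hlaw.1) _) (by positivity)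
    -- The multiplicities of the tuple turn its sum into a weighted sum of distinct, hence
    -- independent, draws.
    set c : Fin n → ℝ := fun i => ∑ a, if j a = i then 1 else 0 with hc
    have hsum : ∀ F : Fin n → ℝ, ∑ i, c i * F i = ∑ a, F (j a) := by
      intro F
      simp only [hc, sum_mul, ite_mul, one_mul, zero_mul]
      rw [sum_comm]
      simp
    have hck : ∑ i, c i = k := by
      have := hsum fun _ => 1
      simpa using this
    have hcne : ∃ i, c i ≠ 0 := by
      by_contra! hall
      simp only [hall, sum_const_zero] at hck
      exact hk.ne (by exact_mod_cast hck)
    have := wprob_few_negative_le h0 h1 T hcne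
    rw [hck] at this
    refine le_trans (le_of_eq ?_) this
    congr 1
    funext g
    have e : ∀ x, ∑ i, c i * (g i x).toReal = ∑ a, (g (j a) x).toReal :=
      fun x => hsum fun i => (g i x).toReal
    simp only [e]

lemma wprob_not_trapping_le {γ : ℝ} (h0 : 0 < γ) (h1 : γ ≤ 1 / 100) {T : Finset X} {s : ℤ}
    (hE : 1 / (4 * #T + 2 : ℝ) ≤ wprob (lawOn γ T) (fun h => labelSum T h = s)) (n : ℕ) {k : ℕ}
    (hk : 0 < k) :
    wprob (piWeight fun _ : Fin n => condWeight (lawOn γ T) fun h => labelSum T h = s)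
      (fun g => ¬ IsTrappingFamily γ T k g) ≤
      Fintype.card X * Real.exp (-(n * γ ^ 2)) +
        (n * (4 * #T + 2)) ^ k * Real.exp (-(#T / 84 : ℝ)) := by
  classical
  have hlaw := lawOn_mem_stdSimplex h0 h1 T
  have hE0 : 0 < wprob (lawOn γ T) (fun h => labelSum T h = s) :=
    lt_of_lt_of_le (by positivity) hE
  have hμ := condWeight_mem_stdSimplex hlaw.1 hE0
  have hpos := piWeight_nonneg (ι := Fin n) fun _ => hμ.1
  have hsub : ∀ g : Fin n → Hypothesis X, ¬ IsTrappingFamily γ T k g →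
      (∃ x ∈ Tᶜ, ∑ j, (g j x).toReal < 2 * γ * n) ∨ ∃ j ∈ (univ : Finset (Fin k → Fin n)),
        (#{x ∈ T | ∑ a, (g (j a) x).toReal ≤ -(4 * γ) * k} : ℝ) < #T / 84 := by
    intro g hg
    by_contra! hc
    exact hg ⟨fun x hx => hc.1 x (mem_compl.2 hx), fun j => hc.2 j (mem_univ _)⟩
  refine (wprob_mono hpos hsub).trans ((wprob_or_le hpos _ _).trans (add_le_add ?_ ?_))
  · refine (wprob_exists_le _ hpos _).trans
      ((sum_le_sum fun x hx => wprob_small_margin_le h0 h1 hE0 (mem_compl.1 hx) n).trans ?_)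
    rw [sum_const, nsmul_eq_mul]
    exact mul_le_mul_of_nonneg_right (by exact_mod_cast card_le_univ _) (Real.exp_nonneg _)
  · refine (wprob_exists_le _ hpos _).trans
      ((sum_le_sum fun j _ => wprob_not_adverse_le h0 h1 hE hk j).trans ?_)
    rw [sum_const, card_univ, Fintype.card_fun, Fintype.card_fin, Fintype.card_fin, nsmul_eq_mul,
      mul_pow]
    push_cast
    rw [mul_assoc]

end Families

/-! ### Rejection sampling. -/

section Selection

variable {Ω : Type*} [Fintype Ω] [DecidableEq Ω]

open Classical in
/-- The first entry of a column that satisfies `E`. -/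
noncomputable def firstGood (E : Ω → Prop) : {R : ℕ} → (Fin R → Ω) → Option Ω
  | 0, _ => none
  | _ + 1, c => if E (c 0) then some (c 0) else firstGood E (Fin.tail c)

omit [Fintype Ω] [DecidableEq Ω] in
lemma exists_of_firstGood_eq_some {E : Ω → Prop} {R : ℕ} {c : Fin R → Ω} {h : Ω}
    (hc : firstGood E c = some h) : ∃ r, c r = h := by
  induction R with
  | zero => simp [firstGood] at hc
  | succ R ih =>
    rw [firstGood] at hc
    split_ifs at hc
    · exact ⟨0, Option.some.inj hc⟩
    · obtain ⟨r, hr⟩ := ih hc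
      exact ⟨r.succ, hr⟩

omit [DecidableEq Ω] in
lemma wprob_fin_succ {R : ℕ} (μ : Ω → ℝ) (p : (Fin (R + 1) → Ω) → Prop) :
    wprob (piWeight fun _ : Fin (R + 1) => μ) p =
      ∑ x, μ x * wprob (piWeight fun _ : Fin R => μ) (fun c => p (Fin.cons x c)) := by
  classical
  simp only [wprob_eq_wmean, wmean, mul_sum]
  rw [← Fintype.sum_prod_type']
  refine (Fintype.sum_equiv (Fin.consEquiv fun _ => Ω) _ _ fun q => ?_).symm
  simp only [Fin.consEquiv, Equiv.coe_fn_mk, piWeight, Fin.prod_univ_succ, Fin.cons_zero,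
    Fin.cons_succ]
  by_cases hp : p (Fin.cons q.1 q.2) <;> simp [hp]

/-- Recursion on the first entry: it is accepted with its own weight, or rejected with probability
`1 - wprob μ E`. The second claim is only an inequality because some mass goes to `none`. -/
lemma wprob_firstGood {μ : Ω → ℝ} (hμ : μ ∈ stdSimplex ℝ Ω) {E : Ω → Prop}
    (hE : 0 < wprob μ E) (R : ℕ) :
    wprob (piWeight fun _ : Fin R => μ) (fun c => firstGood E c = none) = (1 - wprob μ E) ^ R ∧
    ∀ h, wprob (piWeight fun _ : Fin R => μ) (fun c => firstGood E c = some h) ≤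
      condWeight μ E h := by
  classical
  have hcond := condWeight_mem_stdSimplex hμ.1 hE
  have hnot : ∑ x, (if ¬ E x then μ x else 0) = 1 - wprob μ E := by
    have := wprob_add_not hμ E
    rw [wprob_eq_wmean μ fun x => ¬ E x] at this
    simp only [wmean, mul_ite, mul_one, mul_zero] at this
    linarith
  induction R with
  | zero =>
    refine ⟨?_, fun h => ?_⟩
    · simp [firstGood, wprob, piWeight]
    · simp only [firstGood, reduceCtorEq]
      simpa [wprob] using hcond.1 h
  | succ R ih =>
    have htotal : wprob (piWeight fun _ : Fin R => μ) (fun _ => True) = 1 := by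
      simpa [wprob] using (piWeight_mem_stdSimplex fun _ : Fin R => hμ).2
    have hfalse : wprob (piWeight fun _ : Fin R => μ) (fun _ => False) = 0 := by simp [wprob]
    have htail : ∀ x (c : Fin R → Ω), Fin.tail (Fin.cons x c : Fin (R + 1) → Ω) = c :=
      fun x c => Fin.tail_cons _ _
    refine ⟨?_, fun h => ?_⟩
    · rw [wprob_fin_succ, pow_succ']
      nth_rewrite 1 [← hnot]
      rw [sum_mul]
      refine sum_congr rfl fun x _ => ?_
      simp only [firstGood, Fin.cons_zero, htail]
      by_cases hx : E x
      · simp [hx, hfalse]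
      · simp only [hx, if_false, not_false_iff, if_true, ih.1]
    · rw [wprob_fin_succ]
      have hx : ∀ x, μ x * wprob (piWeight fun _ : Fin R => μ)
          (fun c => firstGood E (Fin.cons x c : Fin (R + 1) → Ω) = some h) ≤
          (if E x then (if x = h then μ x else 0) else 0) +
            (if ¬ E x then μ x else 0) * condWeight μ E h := by
        intro x
        simp only [firstGood, Fin.cons_zero, htail]
        by_cases hx : E x
        · by_cases hxh : x = h
          · subst hxh
            simp [hx, htotal]
          · simp [hx, hxh, hfalse]
        · simp only [hx, if_false, not_false_iff, if_true, zero_add]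
          exact mul_le_mul_of_nonneg_left (ih.2 h) (hμ.1 x)
      refine (sum_le_sum fun x _ => hx x).trans ?_
      rw [sum_add_distrib, ← sum_mul, hnot]
      have : ∑ x, (if E x then (if x = h then μ x else 0) else 0) =
          wprob μ E * condWeight μ E h := by
        rw [sum_eq_single h (fun x _ hx => by simp [hx]) (by simp)]
        by_cases hh : E h
        · simp only [hh, if_true, condWeight]; field_simp
        · simp [hh, condWeight]
      rw [this]
      linarith

/-- From independent columns drawn from `μ` one can select, up to a small probability, independent
draws from `μ` conditioned on `E`. -/
lemma wprob_no_selection_le {μ : Ω → ℝ} (hμ : μ ∈ stdSimplex ℝ Ω) {E : Ω → Prop}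
    (hE : 0 < wprob μ E) {n : ℕ} (R : ℕ) (G : (Fin n → Ω) → Prop) :
    wprob (piWeight fun _ : Fin n => piWeight fun _ : Fin R => μ)
      (fun a => ¬ ∃ r : Fin n → Fin R, G fun j => a j (r j)) ≤
      n * (1 - wprob μ E) ^ R +
        wprob (piWeight fun _ : Fin n => condWeight μ E) (fun g => ¬ G g) := by
  classical
  have hcol := piWeight_mem_stdSimplex fun _ : Fin R => hμ
  have harr := piWeight_mem_stdSimplex fun _ : Fin n => hcol
  obtain ⟨hnone, hsome⟩ := wprob_firstGood hμ hE R
  -- Failure means that some column has no good entry, or that the tuple of first good entries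
  -- violates `G`.
  have hsub : ∀ a : Fin n → Fin R → Ω, (¬ ∃ r : Fin n → Fin R, G fun j => a j (r j)) →
      (∃ j ∈ (univ : Finset (Fin n)), firstGood E (a j) = none) ∨
        ∃ g ∈ (univ : Finset (Fin n → Ω)).filter (fun g => ¬ G g),
          ∀ j, firstGood E (a j) = some (g j) := by
    intro a ha
    by_cases h : ∃ j, firstGood E (a j) = none
    · obtain ⟨j, hj⟩ := h
      exact Or.inl ⟨j, mem_univ _, hj⟩
    · right
      push Not at h
      choose g hg using fun j => Option.ne_none_iff_exists'.1 (h j)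
      choose r hr using fun j => exists_of_firstGood_eq_some (hg j)
      refine ⟨g, mem_filter.2 ⟨mem_univ _, fun hG => ha ⟨r, ?_⟩⟩, hg⟩
      simpa only [hr] using hG
  refine (wprob_mono harr.1 hsub).trans ((wprob_or_le harr.1 _ _).trans (add_le_add ?_ ?_))
  · refine (wprob_exists_le _ harr.1 _).trans (le_of_eq ?_)
    have : ∀ j : Fin n, wprob (piWeight fun _ : Fin n => piWeight fun _ : Fin R => μ)
        (fun a => firstGood E (a j) = none) = (1 - wprob μ E) ^ R := by
      intro j
      rw [wprob_eq_wmean, ← hnone, wprob_eq_wmean]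
      exact wmean_piWeight_eval (fun _ => hcol) j fun c => if firstGood E c = none then 1 else 0
    simp [this]
  · refine (wprob_exists_le _ harr.1 _).trans ?_
    rw [wprob]
    refine sum_le_sum_of_subset_of_nonneg (fun g hg => by simpa using hg) (fun g _ _ => ?_) |>.trans
      (sum_le_sum fun g _ => ?_)
    · exact wprob_nonneg harr.1 _
    · have hprod := wmean_piWeight_prod (fun _ : Fin n => piWeight fun _ : Fin R => μ)
        (fun j c => if firstGood E c = some (g j) then (1 : ℝ) else 0)
      have e : wprob (piWeight fun _ : Fin n => piWeight fun _ : Fin R => μ)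
          (fun a => ∀ j, firstGood E (a j) = some (g j)) =
          ∏ j, wprob (piWeight fun _ : Fin R => μ) (fun c => firstGood E c = some (g j)) := by
        simp only [wprob_eq_wmean]
        rw [← hprod]
        congr 1
        funext a
        simp [prod_boole]
      rw [e, piWeight]
      exact prod_le_prod (fun j _ => wprob_nonneg hcol.1 _) fun j _ => hsome (g j)

end Selection

/-! ### One array for all missed sets, and the weak learner. -/

section Existence

variable {X : Type} [Fintype X] [DecidableEq X]

/-- The law of the array does not mention `T`, so the same array can serve many sets. A heavy slice
of the law biased on `T` keeps enough mass under the unbiased law for each column to meet it, and on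
the slice the two conditioned laws agree. -/
lemma wprob_no_trapping_selection_le {γ : ℝ} (h0 : 0 < γ) (h1 : γ ≤ 1 / 100) {T : Finset X}
    (hT : 1 ≤ γ ^ 2 * #T) {n k R : ℕ} (hk : 0 < k)
    (hn : Fintype.card X * Real.exp (-(n * γ ^ 2)) +
      (n * (4 * #T + 2)) ^ k * Real.exp (-(#T / 84 : ℝ)) ≤ 1 / 4)
    (hR : n * Real.exp (-(R * (Real.exp (-(54 * γ ^ 2 * #T)) / (4 * #T + 2)))) ≤ 1 / 4) :
    wprob (piWeight fun _ : Fin n => piWeight fun _ : Fin R => lawOn γ (∅ : Finset X))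
      (fun a => ¬ ∃ r : Fin n → Fin R, IsTrappingFamily γ T k fun j => a j (r j)) ≤ 1 / 2 := by
  classical
  obtain ⟨s, hs, hE⟩ := exists_heavy_slice h0 h1 T hT
  set κ := ((1 + 4 * γ) / (1 - 4 * γ)) ^ s with hκ
  have hκge : Real.exp (-(54 * γ ^ 2 * #T)) ≤ κ := slice_ratio_ge h0 h1 (Nat.cast_nonneg _) hs
  have hκ0 : 0 < κ := lt_of_lt_of_le (Real.exp_pos _) hκge
  have hE0 : 0 < wprob (lawOn γ T) (fun h => labelSum T h = s) :=
    lt_of_lt_of_le (by positivity) hE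
  have hprob : wprob (lawOn γ ∅) (fun h => labelSum T h = s) =
      κ * wprob (lawOn γ T) (fun h => labelSum T h = s) := by
    rw [wprob_eq_wmean, wprob_eq_wmean, wmean, wmean, mul_sum]
    refine sum_congr rfl fun h _ => ?_
    by_cases hh : labelSum T h = s
    · rw [lawOn_empty_eq h0 h1 T h, hh, mul_assoc]
    · simp [hh]
  have hcond : condWeight (lawOn γ ∅) (fun h => labelSum T h = s) =
      condWeight (lawOn γ T) (fun h => labelSum T h = s) := by
    funext h
    rw [condWeight, condWeight]
    split_ifs with hh
    · rw [hprob, lawOn_empty_eq h0 h1 T h, hh, mul_div_mul_left _ _ hκ0.ne']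
    · rfl
  have hlaw := lawOn_mem_stdSimplex h0 h1 (∅ : Finset X)
  have hpos : 0 < wprob (lawOn γ ∅) (fun h => labelSum T h = s) := hprob ▸ mul_pos hκ0 hE0
  refine (wprob_no_selection_le hlaw hpos R fun g => IsTrappingFamily γ T k g).trans ?_
  rw [hcond]
  have h3 := (wprob_not_trapping_le h0 h1 hE n hk).trans hn
  have h4 : (n : ℝ) * (1 - wprob (lawOn γ ∅) (fun h => labelSum T h = s)) ^ R ≤ 1 / 4 := by
    refine le_trans (mul_le_mul_of_nonneg_left ?_ (Nat.cast_nonneg n)) hR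
    have hle1 := wprob_le_one hlaw (fun h => labelSum T h = s)
    have hlow : Real.exp (-(54 * γ ^ 2 * #T)) / (4 * #T + 2) ≤
        wprob (lawOn γ ∅) (fun h => labelSum T h = s) := by
      rw [hprob, div_eq_mul_one_div]
      exact mul_le_mul hκge hE (by positivity) hκ0.le
    calc _ ≤ Real.exp (-wprob (lawOn γ ∅) (fun h => labelSum T h = s)) ^ R := by
          refine pow_le_pow_left₀ (by linarith) ?_ R
          linarith [Real.add_one_le_exp (-wprob (lawOn γ ∅) (fun h => labelSum T h = s))]
      _ ≤ _ := by
          rw [← Real.exp_nat_mul]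
          refine Real.exp_le_exp.2 ?_
          rw [mul_neg, neg_le_neg_iff]
          exact mul_le_mul_of_nonneg_left hlow (Nat.cast_nonneg R)
  linarith

/-- If every likely `s` is good for most `a`, then some `a` is good for many `s`. -/
lemma exists_wprob_ge {A S : Type*} [Fintype A] [Fintype S] {μ : A → ℝ} {σ : S → ℝ}
    (hμ : μ ∈ stdSimplex ℝ A) (hσ : σ ∈ stdSimplex ℝ S) {p : S → Prop} {G : S → A → Prop}
    (hp : 1 / 2 ≤ wprob σ p) (hG : ∀ s, p s → wprob μ (fun a => ¬ G s a) ≤ 1 / 2) :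
    ∃ a, 1 / 4 ≤ wprob σ (fun s => p s ∧ G s a) := by
  classical
  have hswap : wmean μ (fun a => -1 * wprob σ (fun s => p s ∧ G s a)) ≤ -(1 / 4) := by
    rw [wmean_const_mul]
    have e : wmean μ (fun a => wprob σ (fun s => p s ∧ G s a)) =
        wmean σ (fun s => wprob μ (fun a => p s ∧ G s a)) := by
      simp only [wprob_eq_wmean, wmean, mul_sum]
      rw [sum_comm]
      exact sum_congr rfl fun s _ => sum_congr rfl fun a _ => by ring
    have hlow : wmean σ (fun s => 1 / 2 * if p s then (1 : ℝ) else 0) ≤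
        wmean σ (fun s => wprob μ (fun a => p s ∧ G s a)) := by
      refine wmean_mono hσ.1 fun s => ?_
      by_cases hs : p s
      · have := wprob_add_not hμ (G s)
        have := hG s hs
        simp only [hs, true_and, if_true]
        linarith
      · simp only [hs, if_false, mul_zero]
        exact wprob_nonneg hμ.1 _
    rw [wmean_const_mul, ← wprob_eq_wmean] at hlow
    rw [e]
    linarith
  obtain ⟨a, ha⟩ := exists_le_of_wmean_le hμ hswap
  exact ⟨a, by linarith⟩

/-- The points of positive weight. -/
noncomputable def ProbDist.support (D : ProbDist X) : Finset X :=
  open Classical in univ.filter fun x => 0 < D x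

omit [DecidableEq X] in
lemma ProbDist.sum_eq_one (D : ProbDist X) : ∑ x, D x = 1 := D.2.2

omit [DecidableEq X] in
/-- A family with an average of margin `2 γ` on the support of `D` has a member of advantage `γ`. -/
lemma exists_advantage {γ : ℝ} {n : ℕ} (D : ProbDist X) (g : Fin n → Hypothesis X)
    (hn : 0 < n) (hg : ∀ x ∈ D.support, 2 * γ * n ≤ ∑ j, (g j x).toReal) :
    ∃ j, 2 * γ ≤ ∑ x, D x * (g j x).toReal := by
  by_contra! hc
  have h1 : ∑ j, ∑ x, D x * (g j x).toReal < ∑ _j : Fin n, 2 * γ :=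
    sum_lt_sum_of_nonempty ⟨⟨0, hn⟩, mem_univ _⟩ fun j _ => hc j
  rw [sum_comm, sum_const, card_univ, Fintype.card_fin, nsmul_eq_mul] at h1
  have h2 : ∑ x, D x * (2 * γ * n) ≤ ∑ x, ∑ j, D x * (g j x).toReal := by
    refine sum_le_sum fun x _ => ?_
    rw [← mul_sum]
    rcases (D.2.1 x).eq_or_lt with h | h
    · have : D x = 0 := h.symm
      simp [this]
    · exact mul_le_mul_of_nonneg_left (hg x (mem_filter.2 ⟨mem_univ x, h⟩)) h.le
  rw [← sum_mul, D.sum_eq_one] at h2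
  linarith

omit [DecidableEq X] in
/-- A weak learner that answers queries with support `S` by members of the family `fam S`. -/
lemma exists_weakLearner {γ : ℝ} (h1 : γ ≤ 1 / 100) {n : ℕ} (hn : 0 < n)
    {good : Finset X → Prop} {fam : Finset X → Fin n → Hypothesis X}
    (hfam : ∀ S, good S → ∀ x ∈ S, 2 * γ * n ≤ ∑ j, (fam S j x).toReal)
    {H : Finset (Hypothesis X)} (hone : (fun _ => 1) ∈ H)
    (hH : ∀ S, good S → ∀ j, fam S j ∈ H) :
    ∃ W : ProbDist X → Hypothesis X, (∀ D, W D ∈ H) ∧ IsWeakLearner γ (fun _ => 1) W ∧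
      ∀ D, good D.support → ∃ j, W D = fam D.support j := by
  have key : ∀ D : ProbDist X, ∃ h ∈ H, 2 * γ ≤ ∑ x, D x * (h x).toReal ∧
      (good D.support → ∃ j, h = fam D.support j) := by
    intro D
    by_cases hD : good D.support
    · obtain ⟨j, hj⟩ := exists_advantage D (fam D.support) hn (hfam _ hD)
      exact ⟨_, hH _ hD j, hj, fun _ => ⟨j, rfl⟩⟩
    -- On all other supports the target itself is the answer, with advantage sum 1.
    · refine ⟨_, hone, ?_, fun h => absurd h hD⟩
      simp only [Label.toReal_one, mul_one, D.sum_eq_one]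
      linarith
  choose W hW using key
  refine ⟨W, fun D => (hW D).1, fun D => ?_, fun D => (hW D).2.2⟩
  simpa using (hW D).2.1

end Existence

/-! ### VC-dimension from cardinality. -/

section VC

variable {X : Type} [Fintype X] [DecidableEq X]

lemma two_pow_hypVCDim_le {H : Finset (Hypothesis X)} (hH : H.Nonempty) :
    2 ^ hypVCDim H ≤ #H := by
  set 𝒜 := H.image fun h => univ.filter fun x => h x = 1 with h𝒜
  obtain ⟨s, hs, hcard⟩ : ∃ s ∈ 𝒜.shatterer, 𝒜.vcDim = #s :=
    exists_mem_eq_sup _ ⟨∅, mem_shatterer.2 (shatters_empty.2 (hH.image _))⟩ _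
  have h1 := shatters_iff.1 (mem_shatterer.1 hs)
  have h2 : hypVCDim H = #s := hcard
  rw [h2, ← card_powerset, ← h1]
  exact card_image_le.trans card_image_le

end VC

/-! ### Running an algorithm against a trapping family. -/

section Algorithm

variable {X : Type} [Fintype X] {m : ℕ}

lemma Interaction.hypotheses_eq_map (W : ProbDist X → Hypothesis X) (I : Interaction X m) :
    I.hypotheses W = (I.queries W).map fun q => W q.dist := by
  induction I with
  | output f => rfl
  | query q next ih => simp [hypotheses, queries, ih]

/-- Full support forces every query onto `univ.image s`, so each obtained hypothesis is a member of
`g` and the output is a convex vote of such members. -/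
lemma le_errorRate_result [DecidableEq X] {γ : ℝ} (h0 : 0 < γ) {A : LearningAlgorithm X m}
    (hA : SatisfiesProperties γ (fun _ => 1) A) {W : ProbDist X → Hypothesis X}
    (hW : IsWeakLearner γ (fun _ => 1) W) {s : Fin m → X} {n k : ℕ} {g : Fin n → Hypothesis X}
    {T : Finset X} (hg : IsTrappingFamily γ T k g) (hk : 42 ≤ k * γ ^ 2)
    (hWg : ∀ D : ProbDist X, D.support = univ.image s → ∃ j, W D = g j)
    {𝒟 : ProbDist X} {u : ℝ} (h𝒟 : ∀ x, 𝒟 x = 1 / u) (hu : 0 < u) :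
    #T / 168 / u ≤ errorRate 𝒟 (fun _ => 1) ((A (labelled (fun _ => 1) s)).result W) := by
  classical
  obtain ⟨ω, hω⟩ := hA.weightedMajority
  obtain ⟨hw, hres⟩ := hω s W hW
  set hs := (A (labelled (fun _ => 1) s)).hypotheses W with hhs
  set w := ω (labelled (fun _ => 1) s) hs.length fun i j => hs.get i (s j)
  have hmem : ∀ h ∈ hs, ∃ j, h = g j := by
    intro h hh
    rw [hhs, Interaction.hypotheses_eq_map, List.mem_map] at hh
    obtain ⟨q, hq, he⟩ := hh
    obtain ⟨j, hj⟩ := hWg q.dist (by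
      ext x
      have := hA.fullSupport s W hW q hq x
      simpa [ProbDist.support] using this)
    exact ⟨j, by rw [← he, hj]⟩
  choose φ hφ using fun i => hmem (hs.get i) (List.get_mem _ _)
  have hneg := hg.card_negative_ge h0 hk hw φ
  have herr : errorRate 𝒟 (fun _ => 1) ((A (labelled (fun _ => 1) s)).result W) =
      #{x | (A (labelled (fun _ => 1) s)).result W x ≠ 1} / u := by
    rw [errorRate, sum_congr rfl fun x _ => h𝒟 x, sum_const, nsmul_eq_mul, mul_one_div]
  rw [herr]
  refine div_le_div_of_nonneg_right (hneg.trans ?_) hu.le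
  norm_cast
  refine card_le_card fun x hx => ?_
  simp only [mem_filter, mem_univ, true_and] at hx ⊢
  rw [hres, vote]
  simp only [hφ]
  rw [if_pos hx.2]
  decide

end Algorithm

/-! ### Points missed by a random sample. -/

section Occupancy

lemma one_sub_ge_exp {x : ℝ} (h0 : 0 ≤ x) (h1 : x ≤ 1 / 2) : Real.exp (-(2 * x)) ≤ 1 - x := by
  rw [Real.exp_neg, inv_le_comm₀ (Real.exp_pos _) (by linarith)]
  refine le_trans ?_ (Real.add_one_le_exp _)
  rw [inv_le_iff_one_le_mul₀ (by linarith)]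
  nlinarith

/-- Many points are missed by `m` uniform draws from `u` points. -/
lemma wprob_missed_ge {u m : ℕ} (hu : 2 ≤ u) {𝒟 : Fin u → ℝ} (h𝒟 : ∀ x, 𝒟 x = 1 / (u : ℝ))
    (hM : 8 ≤ u * Real.exp (-(2 * m / u))) :
    1 / 2 ≤ wprob (piWeight fun _ : Fin m => 𝒟)
      (fun s => u * Real.exp (-(2 * m / u)) / 2 ≤ (#(univ.image s)ᶜ : ℝ)) := by
  classical
  have hu' : (2 : ℝ) ≤ u := by exact_mod_cast hu
  have hmem : 𝒟 ∈ stdSimplex ℝ (Fin u) := by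
    refine ⟨fun x => by rw [h𝒟]; positivity, ?_⟩
    simp only [h𝒟, sum_const, card_univ, Fintype.card_fin, nsmul_eq_mul]
    field_simp
  have hprod := piWeight_mem_stdSimplex fun _ : Fin m => hmem
  set q := (1 - 1 / (u : ℝ)) ^ m with hq
  have hq0 : 0 ≤ q := pow_nonneg (by
    rw [sub_nonneg, div_le_one (by linarith)]; linarith) m
  have hqge : Real.exp (-(2 * m / u)) ≤ q := by
    have := one_sub_ge_exp (x := 1 / (u : ℝ)) (by positivity)
      (one_div_le_one_div_of_le (by norm_num) hu')
    calc _ = Real.exp (-(2 * (1 / (u : ℝ)))) ^ m := by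
          rw [← Real.exp_nat_mul]; congr 1; ring
      _ ≤ q := pow_le_pow_left₀ (Real.exp_nonneg _) this m
  set M := u * q with hMdef
  have hMge : u * Real.exp (-(2 * m / u)) ≤ M := mul_le_mul_of_nonneg_left hqge (by positivity)
  set φ : Fin u → Fin u → ℝ := fun i y => if y = i then 0 else 1 with hφ
  set Z : (Fin m → Fin u) → ℝ := fun s => ∑ i, ∏ l, φ i (s l) with hZ
  have hcard : ∀ s : Fin m → Fin u, Z s = #(univ.image s)ᶜ := by
    intro s
    have : ∀ i, ∏ l, φ i (s l) = if i ∈ (univ.image s)ᶜ then 1 else 0 := by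
      intro i
      by_cases h : ∃ l, s l = i
      · obtain ⟨l, hl⟩ := h
        rw [prod_eq_zero (mem_univ l) (by simp [hφ, hl]), if_neg (by simp; exact ⟨l, hl⟩)]
      · push Not at h
        rw [prod_eq_one fun l _ => by simp [hφ, h l], if_pos (by simpa using h)]
    simp only [hZ, this, sum_boole, filter_mem_eq_inter, univ_inter]
  have hone : ∀ i, wmean 𝒟 (φ i) = 1 - 1 / u := by
    intro i
    have e : φ i = fun y => 1 + -1 * (if y = i then (1 : ℝ) else 0) := by
      funext y; simp only [hφ]; split_ifs <;> norm_num
    rw [e, wmean_add, wmean_const_mul, wmean_const hmem, wmean]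
    simp [h𝒟]
    ring
  have htwo : ∀ i j, i ≠ j → wmean 𝒟 (fun y => φ i y * φ j y) = 1 - 2 / u := by
    intro i j hij
    have e : (fun y => φ i y * φ j y) = fun y => 1 + (-1 * (if y = i then (1 : ℝ) else 0) +
        -1 * (if y = j then (1 : ℝ) else 0)) := by
      funext y; simp only [hφ]
      by_cases h1 : y = i
      · have : y ≠ j := fun h => hij (h1.symm.trans h)
        simp [h1, hij]
      · simp [h1]; split_ifs <;> norm_num
    rw [e, wmean_add, wmean_add, wmean_const_mul, wmean_const_mul, wmean_const hmem, wmean, wmean]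
    simp [h𝒟]
    ring
  have hEZ : wmean (piWeight fun _ : Fin m => 𝒟) Z = M := by
    rw [hZ, wmean_sum]
    have : ∀ i, wmean (piWeight fun _ : Fin m => 𝒟) (fun s => ∏ l, φ i (s l)) = q := by
      intro i
      rw [wmean_piWeight_prod (fun _ : Fin m => 𝒟) fun _ => φ i]
      simp [hone, hq]
    simp only [this]
    simp [hMdef]
  -- Missing two distinct points is negatively correlated, since `1 - 2/u ≤ (1 - 1/u)²`. So the
  -- variance is at most `M`, and Chebyshev at `M / 2` fails with probability at most `4 / M ≤ 1/2`.
  have hEZ2 : wmean (piWeight fun _ : Fin m => 𝒟) (fun s => Z s ^ 2) ≤ M + M ^ 2 := by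
    have e : (fun s => Z s ^ 2) = fun s => ∑ i, ∑ j, ∏ l, φ i (s l) * φ j (s l) := by
      funext s
      simp only [hZ, sq, sum_mul_sum, prod_mul_distrib]
    rw [e, wmean_sum]
    simp only [wmean_sum]
    have : ∀ i j, wmean (piWeight fun _ : Fin m => 𝒟) (fun s => ∏ l, φ i (s l) * φ j (s l)) ≤
        (if i = j then q else 0) + q ^ 2 := by
      intro i j
      rw [wmean_piWeight_prod (fun _ : Fin m => 𝒟) fun _ y => φ i y * φ j y]
      simp only [prod_const, card_univ, Fintype.card_fin]
      by_cases hij : i = j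
      · subst hij
        have : (fun y => φ i y * φ i y) = φ i := by
          funext y; simp only [hφ]; split_ifs <;> norm_num
        rw [this, hone, if_pos rfl]
        nlinarith [sq_nonneg q]
      · rw [htwo i j hij, if_neg hij, zero_add, hq, ← pow_mul, mul_comm m 2, pow_mul]
        refine pow_le_pow_left₀ ?_ ?_ m
        · rw [sub_nonneg, div_le_one (by linarith)]; exact hu'
        · have : (0 : ℝ) ≤ (1 / u) ^ 2 := sq_nonneg _
          have : (2 : ℝ) / u = 2 * (1 / u) := by ring
          nlinarith
    refine (sum_le_sum fun i _ => sum_le_sum fun j _ => this i j).trans (le_of_eq ?_)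
    simp [sum_add_distrib, hMdef]
    ring
  have hbad : wprob (piWeight fun _ : Fin m => 𝒟)
      (fun s => ¬ u * Real.exp (-(2 * m / u)) / 2 ≤ (#(univ.image s)ᶜ : ℝ)) ≤ 1 / 2 := by
    have hM0 : 0 < M := by linarith
    have := wprob_le_wmean hprod.1 (F := fun s => (4 / M ^ 2) * (M ^ 2 + (-2 * M * Z s + Z s ^ 2)))
      (fun s => by
        have : M ^ 2 + (-2 * M * Z s + Z s ^ 2) = (M - Z s) ^ 2 := by ring
        rw [this]; positivity)
      (p := fun s => ¬ u * Real.exp (-(2 * m / u)) / 2 ≤ (#(univ.image s)ᶜ : ℝ)) (fun s hs => by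
        rw [← hcard] at hs
        push Not at hs
        rw [div_mul_eq_mul_div, le_div_iff₀ (by positivity)]
        nlinarith)
    rw [wmean_const_mul, wmean_add, wmean_add, wmean_const_mul, wmean_const hprod, hEZ] at this
    refine this.trans ?_
    calc _ ≤ 4 / M ^ 2 * M := mul_le_mul_of_nonneg_left (by linarith) (by positivity)
      _ = 4 / M := by field_simp
      _ ≤ 1 / 2 := by rw [div_le_div_iff₀ hM0 (by norm_num)]; linarith
  have := wprob_add_not hprod
    (fun s => u * Real.exp (-(2 * m / u)) / 2 ≤ (#(univ.image s)ᶜ : ℝ))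
  linarith

end Occupancy

/-! ### Choice of the sizes. -/

section Parameters

set_option maxHeartbeats 1000000 in
/-- The sizes used in the construction. -/
lemma exists_parameters {γ d : ℝ} {m : ℕ} (h0 : 0 < γ) (h1 : γ ≤ 1 / 10000000)
    (hd : Real.log (1 / γ) ≤ d) (hx : 1 < m * γ ^ 2 / d) (hm : (m : ℝ) ≤ Real.exp (Real.exp d)) :
    ∃ u t k n R : ℕ, 2 ≤ u ∧ 8 ≤ u * Real.exp (-(2 * m / u)) ∧
      (t : ℝ) ≤ u * Real.exp (-(2 * m / u)) / 2 ∧ 1 ≤ γ ^ 2 * t ∧ 0 < n ∧ 42 ≤ k * γ ^ 2 ∧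
      u * Real.exp (-(n * γ ^ 2)) + (n * (4 * t + 2)) ^ k * Real.exp (-(t / 84 : ℝ)) ≤ 1 / 4 ∧
      n * Real.exp (-(R * (Real.exp (-(54 * γ ^ 2 * t)) / (4 * t + 2)))) ≤ 1 / 4 ∧
      (n * R + 1 : ℝ) ≤ Real.exp (3000000 * d) ∧
      1 / 1680 * (d * Real.log (m * γ ^ 2 / d) / (m * γ ^ 2)) ≤ t / 168 / u := by
  set e := Real.exp d with he
  -- From here on, powers of `1 / γ` are absorbed into powers of `exp d`.
  have hinv : 1 / γ ≤ e := by
    rw [he, ← Real.log_le_iff_le_exp (by positivity)]; exact hd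
  have hinv7 : (10000000 : ℝ) ≤ 1 / γ := by
    rw [le_div_iff₀ h0]; linarith
  have he7 : 10000000 ≤ e := hinv7.trans hinv
  have hd1 : 1 ≤ d := by
    refine le_trans ?_ hd
    rw [Real.le_log_iff_exp_le (by positivity)]
    linarith [Real.exp_one_lt_d9]
  have hde : d ≤ e := by linarith [Real.add_one_le_exp d]
  obtain ⟨q, hq⟩ : ∃ q, q = 1 / γ ^ 2 := ⟨_, rfl⟩
  have hqγ : q * γ ^ 2 = 1 := by rw [hq]; field_simp
  have hqe : q ≤ e ^ 2 := by
    rw [hq, ← one_div_pow]; exact pow_le_pow_left₀ (by positivity) hinv 2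
  have hq7 : 10000000 ≤ q := by
    rw [hq, ← one_div_pow]
    exact hinv7.trans (le_self_pow₀ (by linarith) two_ne_zero)
  obtain ⟨τ, hτ⟩ : ∃ τ, τ = d * q := ⟨_, rfl⟩
  have hτγ : τ * γ ^ 2 = d := by rw [hτ, mul_assoc, hqγ, mul_one]
  have hτ7 : 10000000 ≤ τ := hτ ▸ hq7.trans (le_mul_of_one_le_left (by linarith) hd1)
  have hτe : τ ≤ e ^ 3 := by
    rw [hτ, pow_succ']
    exact mul_le_mul hde hqe (by linarith) (by linarith)
  have hγ2 : 0 < γ ^ 2 := by positivity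
  obtain ⟨x, hxdef⟩ : ∃ x, x = m * γ ^ 2 / d := ⟨_, rfl⟩
  rw [← hxdef] at hx ⊢
  have hmx : (m : ℝ) = x * τ := by
    rw [hxdef, hτ, hq]; field_simp
  have hm0 : (0 : ℝ) < m := by rw [hmx]; positivity
  -- The maximum keeps the universe of size `O(m)` when `x` is close to 1.
  set L := max 1 (Real.log x) with hL
  have hL1 : 1 ≤ L := le_max_left _ _
  have hLx : L ≤ x := max_le hx.le (by linarith [Real.log_le_sub_one_of_pos (by linarith : 0 < x)])
  have hxL : Real.exp (L - 1) ≤ x := by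
    rcases le_total 1 (Real.log x) with h | h
    · rw [hL, max_eq_right h]
      calc _ ≤ Real.exp (Real.log x) := Real.exp_le_exp.2 (by linarith)
        _ = x := Real.exp_log (by linarith)
    · rw [hL, max_eq_left h]; simpa using hx.le
  have hLm : L ≤ m := hmx ▸ hLx.trans (le_mul_of_one_le_right (by linarith) (by linarith))
  -- the number of missed points
  set t := ⌊200000 * τ / 4⌋₊ with ht
  have htle : (t : ℝ) ≤ 50000 * τ := by
    have := Nat.floor_le (show 0 ≤ 200000 * τ / 4 by positivity)
    linarith
  have htge : 40000 * τ ≤ t := by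
    have := Nat.lt_floor_add_one (200000 * τ / 4)
    linarith
  -- the size of the universe
  set u := ⌈200000 * m / L⌉₊ with hu
  have hBL : 200000 ≤ 200000 * m / L := by rw [le_div_iff₀ (by linarith)]; linarith
  have huge : 200000 * m / L ≤ (u : ℝ) := Nat.le_ceil _
  have hule : (u : ℝ) ≤ 400000 * m / L := by
    have := (Nat.ceil_lt_add_one (show 0 ≤ 200000 * m / L by positivity)).le
    have e2 : 400000 * m / L = 200000 * m / L + 200000 * m / L := by ring
    linarith
  have hu0 : (0 : ℝ) < u := by linarith
  have hu2 : 2 ≤ u := by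
    have : (2 : ℝ) ≤ u := by linarith
    exact_mod_cast this
  have hexp : Real.exp (-(L / 2)) ≤ Real.exp (-(2 * m / u)) := by
    refine Real.exp_le_exp.2 (neg_le_neg ?_)
    rw [div_le_iff₀ hu0]
    rw [div_le_iff₀ (by linarith)] at huge
    have : 0 ≤ L * u := by positivity
    linarith
  -- Since `exp (L - 1) ≤ x` and `L / 2 ≤ exp (L / 2 - 1)`, one has `x * exp (-L / 2) ≥ L / 2`,
  -- which cancels the `L` in the size of the universe.
  have hmiss : 100000 * τ ≤ u * Real.exp (-(2 * m / u)) := by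
    have h2 : 200000 * m / L * Real.exp (-(L / 2)) ≤ u * Real.exp (-(2 * m / u)) :=
      mul_le_mul huge hexp (Real.exp_nonneg _) hu0.le
    refine le_trans ?_ h2
    have h3 : L / 2 ≤ x * Real.exp (-(L / 2)) := by
      calc L / 2 ≤ Real.exp (L / 2 - 1) := by linarith [Real.add_one_le_exp (L / 2 - 1)]
        _ = Real.exp (L - 1) * Real.exp (-(L / 2)) := by rw [← Real.exp_add]; congr 1; ring
        _ ≤ _ := mul_le_mul_of_nonneg_right hxL (Real.exp_nonneg _)
    rw [div_mul_eq_mul_div, le_div_iff₀ (by linarith), hmx]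
    have := mul_le_mul_of_nonneg_left h3 (by positivity : 0 ≤ 200000 * τ)
    linarith
  -- the size of a family
  have hlogu : Real.log (8 * u) ≤ 2 * e := by
    -- The doubly exponential bound on `m` makes the logarithm of the universe size, hence `n`, at
    -- most `exp (O(d))`.
    rw [Real.log_le_iff_le_exp (by positivity), two_mul, Real.exp_add]
    have h2 : (u : ℝ) ≤ 400000 * m := hule.trans (div_le_self (by positivity) hL1)
    have h3 := Real.quadratic_le_exp_of_nonneg (show 0 ≤ e by linarith)
    have h4 : 3200000 ≤ Real.exp e := by linarith [sq_nonneg e]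
    calc 8 * (u : ℝ) ≤ 3200000 * m := by linarith
      _ ≤ _ := mul_le_mul h4 hm hm0.le (Real.exp_nonneg _)
  have hlogu0 : 0 < Real.log (8 * u) := Real.log_pos (by linarith)
  set n := ⌈Real.log (8 * u) * q⌉₊ with hn
  have hn0 : 0 < n := Nat.ceil_pos.2 (by positivity)
  have hn1 : (1 : ℝ) ≤ n := by exact_mod_cast hn0
  have hnge : Real.log (8 * u) ≤ n * γ ^ 2 := by
    have : Real.log (8 * u) * q ≤ n := Nat.le_ceil _
    calc _ = Real.log (8 * u) * q * γ ^ 2 := by rw [mul_assoc, hqγ, mul_one]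
      _ ≤ _ := mul_le_mul_of_nonneg_right this hγ2.le
  have hnle : (n : ℝ) ≤ 3 * e ^ 3 := by
    have h2 := (Nat.ceil_lt_add_one (show 0 ≤ Real.log (8 * u) * q by positivity)).le
    have h3 : Real.log (8 * u) * q ≤ 2 * e * e ^ 2 :=
      mul_le_mul hlogu hqe (by linarith) (by linarith)
    have h4 : 1 ≤ e ^ 3 := one_le_pow₀ (by linarith)
    linarith
  have hΛ : 4 * (t : ℝ) + 2 ≤ 400000 * e ^ 3 := by linarith
  have hnΛ : (n : ℝ) * (4 * t + 2) ≤ Real.exp (7 * d) := by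
    calc (n : ℝ) * (4 * t + 2) ≤ 3 * e ^ 3 * (400000 * e ^ 3) :=
          mul_le_mul hnle hΛ (by positivity) (by positivity)
      _ = 1200000 * e ^ 6 := by ring
      _ ≤ e * e ^ 6 := mul_le_mul_of_nonneg_right (by linarith) (by positivity)
      _ = Real.exp (7 * d) := by rw [he, ← pow_succ', ← Real.exp_nat_mul]; norm_num
  -- the sparsity
  set k := ⌈42 * q⌉₊ with hk
  have hkge : 42 * q ≤ (k : ℝ) := Nat.le_ceil _
  have hkle : (k : ℝ) ≤ 43 * q := by
    have := (Nat.ceil_lt_add_one (show 0 ≤ 42 * q by linarith)).le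
    linarith
  -- the number of columns
  set ε := Real.exp (-(54 * γ ^ 2 * t)) / (4 * t + 2) with hε
  have hε0 : 0 < ε := by positivity
  -- The exponent is `54 * 50000 * d`, from `γ² t ≤ 50000 d`.
  have hεinv : 1 / ε ≤ 400000 * e ^ 3 * Real.exp (2700000 * d) := by
    rw [hε, one_div_div, Real.exp_neg, div_inv_eq_mul]
    refine mul_le_mul hΛ (Real.exp_le_exp.2 ?_) (Real.exp_nonneg _) (by positivity)
    have := mul_le_mul_of_nonneg_left htle hγ2.le
    linarith
  set R := ⌈4 * n / ε⌉₊ with hR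
  have hRge : 4 * n / ε ≤ (R : ℝ) := Nat.le_ceil _
  have hRle : (R : ℝ) ≤ 4 * n / ε + 1 :=
    (Nat.ceil_lt_add_one (show 0 ≤ 4 * n / ε by positivity)).le
  refine ⟨u, t, k, n, R, hu2, by linarith, by linarith, ?_, hn0, ?_, ?_, ?_, ?_, ?_⟩
  · have := mul_le_mul_of_nonneg_left htge hγ2.le
    linarith
  · have := mul_le_mul_of_nonneg_right hkge hγ2.le
    linarith
  · have h2 : u * Real.exp (-(n * γ ^ 2)) ≤ 1 / 8 := by
      calc _ ≤ u * Real.exp (-Real.log (8 * u)) :=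
            mul_le_mul_of_nonneg_left (Real.exp_le_exp.2 (neg_le_neg hnge)) hu0.le
        _ = 1 / 8 := by
            rw [Real.exp_neg, Real.exp_log (by positivity)]; field_simp
    have h3 : ((n : ℝ) * (4 * t + 2)) ^ k * Real.exp (-(t / 84 : ℝ)) ≤ 1 / 8 := by
      calc _ ≤ Real.exp (7 * d) ^ k * Real.exp (-(t / 84 : ℝ)) :=
            mul_le_mul_of_nonneg_right (pow_le_pow_left₀ (by positivity) hnΛ k)
              (Real.exp_nonneg _)
        _ = Real.exp (k * (7 * d) - t / 84) := by
            rw [← Real.exp_nat_mul, ← Real.exp_add]; congr 1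
        _ ≤ Real.exp (-τ) := by
            refine Real.exp_le_exp.2 ?_
            -- The tuples cost `7 * 43 = 301` times `τ`, while `t / 84` is at least `476 τ`; this
            -- dictates the large constant in `t`.
            have : (k : ℝ) * d ≤ 43 * τ := by
              have := mul_le_mul_of_nonneg_right hkle (by linarith : 0 ≤ d)
              rw [hτ]
              linarith
            linarith
        _ ≤ 1 / 8 := by
            rw [Real.exp_neg, one_div]
            exact inv_anti₀ (by norm_num) (by linarith [Real.add_one_le_exp τ])
    linarith
  · have h2 : 4 * (n : ℝ) ≤ R * ε := by rwa [div_le_iff₀ hε0] at hRge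
    calc _ ≤ n * Real.exp (-(4 * n)) :=
          mul_le_mul_of_nonneg_left (Real.exp_le_exp.2 (neg_le_neg h2)) (by positivity)
      _ ≤ 1 / 4 := by
          rw [Real.exp_neg, mul_inv_le_iff₀ (Real.exp_pos _)]
          linarith [Real.add_one_le_exp (4 * (n : ℝ))]
  · have hE1 : 1 ≤ Real.exp (2700000 * d) := Real.one_le_exp (by positivity)
    have he1 : 1 ≤ e ^ 3 := one_le_pow₀ (by linarith)
    have h2 : (n : ℝ) * R ≤ n * (4 * n * (400000 * e ^ 3 * Real.exp (2700000 * d)) + 1) := by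
      refine mul_le_mul_of_nonneg_left (hRle.trans ?_) (by positivity)
      have := mul_le_mul_of_nonneg_left hεinv (by positivity : (0 : ℝ) ≤ 4 * n)
      rw [mul_one_div] at this
      linarith
    have h5 : (n : ℝ) * n ≤ 9 * e ^ 6 := by
      calc (n : ℝ) * n ≤ 3 * e ^ 3 * (3 * e ^ 3) :=
            mul_le_mul hnle hnle (by positivity) (by positivity)
        _ = 9 * e ^ 6 := by ring
    have h6 : (n : ℝ) * (4 * n * (400000 * e ^ 3 * Real.exp (2700000 * d))) ≤
        9 * e ^ 6 * (1600000 * e ^ 3 * Real.exp (2700000 * d)) := by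
      calc _ = (n : ℝ) * n * (1600000 * e ^ 3 * Real.exp (2700000 * d)) := by ring
        _ ≤ _ := mul_le_mul_of_nonneg_right h5 (by positivity)
    have h7 : 1 ≤ e ^ 6 * Real.exp (2700000 * d) :=
      one_le_mul_of_one_le_of_one_le (one_le_pow₀ (by linarith)) hE1
    have h8 : (n : ℝ) + 1 ≤ 4 * e ^ 3 * (e ^ 6 * Real.exp (2700000 * d)) :=
      le_trans (by linarith) (le_mul_of_one_le_right (by positivity) h7)
    have h9 : (n * R + 1 : ℝ) ≤ e ^ 2 * e ^ 9 * Real.exp (2700000 * d) := by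
      have : (n * R + 1 : ℝ) ≤ 14400004 * (e ^ 9 * Real.exp (2700000 * d)) := by linarith
      refine this.trans ?_
      rw [mul_assoc]
      exact mul_le_mul_of_nonneg_right
        (le_trans (by norm_num) (pow_le_pow_left₀ (by norm_num) he7 2)) (by positivity)
    refine h9.trans ?_
    rw [he, ← pow_add, ← Real.exp_nat_mul, ← Real.exp_add]
    refine Real.exp_le_exp.2 ?_
    push_cast
    linarith
  · have h2 : d * Real.log x / (m * γ ^ 2) = τ * Real.log x / m := by
      rw [← hτγ]; field_simp
    have h3 : Real.log x ≤ L := le_max_right _ _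
    rw [h2, div_div, le_div_iff₀ (by positivity)]
    rw [le_div_iff₀ (by linarith)] at hule
    have hlog0 : 0 ≤ Real.log x := Real.log_nonneg hx.le
    have h4 : Real.log x * u ≤ 400000 * m := by
      have := mul_le_mul_of_nonneg_right h3 hu0.le
      linarith
    calc 1 / 1680 * (τ * Real.log x / m) * (168 * u) = τ / 10 * (Real.log x * u) / m := by ring
      _ ≤ τ / 10 * (400000 * m) / m := by gcongr
      _ = 40000 * τ := by field_simp; norm_num
      _ ≤ t := htge

end Parameters

/-! ### Assembly of the hard class. -/

section Main

/-- The uniform distribution on `Fin u`. -/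
noncomputable def uniformDist (u : ℕ) (hu : 0 < u) : ProbDist (Fin u) :=
  ⟨fun _ => 1 / (u : ℝ), fun _ => by positivity, by
    have : (u : ℝ) ≠ 0 := by positivity
    simp [this]⟩

lemma uniformDist_apply (u : ℕ) (hu : 0 < u) (x : Fin u) : uniformDist u hu x = 1 / (u : ℝ) := rfl

lemma sampleProb_eq_wprob {X : Type} [Fintype X] (D : ProbDist X) (m : ℕ)
    (E : (Fin m → X) → Prop) : sampleProb D m E = wprob (piWeight fun _ : Fin m => ⇑D) E := rfl

lemma errorRate_nonneg {X : Type} [Fintype X] (D : ProbDist X) (c f : Hypothesis X) :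
    0 ≤ errorRate D c f :=
  sum_nonneg fun x _ => D.2.1 x

/-- The array is fixed before the algorithm is known, and a family is then chosen inside it for each
good support. The weak learner depends only on these choices, so it defeats all algorithms on the
same samples. -/
lemma exists_hard_class {γ d : ℝ} {m : ℕ} (h0 : 0 < γ) (h1 : γ ≤ 1 / 10000000)
    (hd : Real.log (1 / γ) ≤ d) (hx : 1 < m * γ ^ 2 / d) (hm : (m : ℝ) ≤ Real.exp (Real.exp d)) :
    ∃ (u : ℕ) (𝒟 : ProbDist (Fin u)) (H : Finset (Hypothesis (Fin u)))
      (W : ProbDist (Fin u) → Hypothesis (Fin u)),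
      (∀ x, 𝒟 x = 1 / (u : ℝ)) ∧ (hypVCDim H : ℝ) ≤ 6000000 * d ∧ (∀ D, W D ∈ H) ∧
      IsWeakLearner γ (fun _ => 1) W ∧
      ∀ A : LearningAlgorithm (Fin u) m, SatisfiesProperties γ (fun _ => 1) A →
        1 / 4 ≤ sampleProb 𝒟 m fun s =>
          1 / 1680 * (d * Real.log (m * γ ^ 2 / d) / (m * γ ^ 2)) ≤
            errorRate 𝒟 (fun _ => 1) ((A (labelled (fun _ => 1) s)).result W) := by
  classical
  obtain ⟨u, t, k, n, R, hu2, hu8, htu, hγt, hn0, hk, hN, hR, hcard, herr⟩ :=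
    exists_parameters h0 h1 hd hx hm
  have hγ : γ ≤ 1 / 100 := h1.trans (by norm_num)
  have hu0 : 0 < u := by omega
  have hk0 : 0 < k := by
    rcases Nat.eq_zero_or_pos k with h | h
    · rw [h] at hk; norm_num at hk
    · exact h
  set 𝒟 := uniformDist u hu0 with h𝒟def
  have h𝒟 : ∀ x, 𝒟 x = 1 / (u : ℝ) := uniformDist_apply u hu0
  -- a `t`-subset of the points that are missed
  have hpick : ∀ S : Finset (Fin u), t ≤ #Sᶜ → ∃ T ⊆ Sᶜ, #T = t :=
    fun S hS => exists_subset_card_eq hS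
  choose! pick hpick using hpick
  set σ : (Fin m → Fin u) → ℝ := piWeight fun _ => ⇑𝒟 with hσdef
  have hσ : σ ∈ stdSimplex ℝ (Fin m → Fin u) := piWeight_mem_stdSimplex fun _ => 𝒟.2
  have hlaw := lawOn_mem_stdSimplex h0 hγ (∅ : Finset (Fin u))
  have hμ := piWeight_mem_stdSimplex fun _ : Fin n => piWeight_mem_stdSimplex fun _ : Fin R => hlaw
  have hmissed : 1 / 2 ≤ wprob σ (fun s => t ≤ #(univ.image s)ᶜ) := by
    refine (wprob_missed_ge hu2 h𝒟 hu8).trans (wprob_mono hσ.1 fun s hs => ?_)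
    exact_mod_cast htu.trans hs
  -- Half of the samples miss enough points, and for each of these the array succeeds with
  -- probability at least 1/2: some array serves a quarter of the samples.
  obtain ⟨a, ha⟩ := exists_wprob_ge hμ hσ (G := fun s a => ∃ r : Fin n → Fin R,
      IsTrappingFamily γ (pick (univ.image s)) k fun j => a j (r j)) hmissed fun s hs => by
    have hT := (hpick _ hs).2
    refine wprob_no_trapping_selection_le h0 hγ ?_ hk0 ?_ ?_ <;> rw [hT]
    · exact hγt
    · simpa using hN
    · exact hR
  set good : Finset (Fin u) → Prop := fun S => t ≤ #Sᶜ ∧ ∃ r : Fin n → Fin R,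
    IsTrappingFamily γ (pick S) k fun j => a j (r j) with hgood
  have hsel : ∀ S, ∃ fam : Fin n → Hypothesis (Fin u), good S →
      (∀ j, ∃ r, fam j = a j r) ∧ IsTrappingFamily γ (pick S) k fam := by
    intro S
    by_cases hS : good S
    · obtain ⟨r, hr⟩ := hS.2
      exact ⟨fun j => a j (r j), fun _ => ⟨fun j => ⟨r j, rfl⟩, hr⟩⟩
    · exact ⟨fun _ _ => 1, fun h => absurd h hS⟩
  choose fam hfam using hsel
  set H : Finset (Hypothesis (Fin u)) :=
    insert (fun _ => 1) (univ.image fun q : Fin n × Fin R => a q.1 q.2) with hH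
  have hHcard : (#H : ℝ) ≤ n * R + 1 := by
    have h2 : #H ≤ n * R + 1 := by
      refine (card_insert_le _ _).trans (Nat.add_le_add_right (card_image_le.trans ?_) 1)
      simp
    exact_mod_cast h2
  obtain ⟨W, hWH, hW, hWfam⟩ := exists_weakLearner hγ hn0 (good := good) (fam := fam)
    (fun S hS x hxS => (hfam S hS).2.margin x fun hxT =>
      mem_compl.1 ((hpick S hS.1).1 hxT) hxS)
    (H := H) (mem_insert_self _ _) fun S hS j => by
      obtain ⟨r, hr⟩ := (hfam S hS).1 j
      rw [hr]
      exact mem_insert_of_mem (mem_image.2 ⟨(j, r), mem_univ _, rfl⟩)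
  refine ⟨u, 𝒟, H, W, h𝒟, ?_, hWH, hW, fun A hA => ?_⟩
  · have h2 : (2 : ℝ) ^ hypVCDim H ≤ #H := by
      exact_mod_cast two_pow_hypVCDim_le ⟨_, mem_insert_self _ _⟩
    have h3 := Real.log_le_log (by positivity) (h2.trans (hHcard.trans hcard))
    rw [Real.log_pow, Real.log_exp] at h3
    -- As `log 2 > 1/2`, the exponent `3000000 d` of the class size at most doubles.
    have h4 := Real.log_two_gt_d9
    have h5 : (0 : ℝ) ≤ hypVCDim H := Nat.cast_nonneg _
    nlinarith
  · rw [sampleProb_eq_wprob]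
    refine ha.trans (wprob_mono hσ.1 fun s hs => herr.trans ?_)
    have hgs : good (univ.image s) := hs
    have := le_errorRate_result h0 hA hW (hfam _ hgs).2 hk (fun D hD => by
      obtain ⟨j, hj⟩ := hWfam D (hD ▸ hgs)
      exact ⟨j, by rw [hj, hD]⟩) h𝒟 (by positivity)
    rwa [(hpick _ hgs.1).2] at this

theorem theorem2 :
    ∃ c K C p : ℝ, 0 < c ∧ c ≤ 1 ∧ 0 < K ∧ 0 < C ∧ 0 < p ∧
      ∀ (γ d : ℝ) (m : ℕ), 0 < γ → γ ≤ c → Real.log (1 / γ) ≤ d →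
        d * (γ ^ 2)⁻¹ / 16 ≤ (m : ℝ) → (m : ℝ) ≤ Real.exp (Real.exp d) →
        ∃ (u : ℕ) (𝒟 : ProbDist (Fin u)) (H : Finset (Hypothesis (Fin u)))
          (W : ProbDist (Fin u) → Hypothesis (Fin u)),
          (∀ x, 𝒟 x = 1 / (u : ℝ)) ∧
          (hypVCDim H : ℝ) ≤ K * d ∧
          (∀ D, W D ∈ H) ∧
          IsWeakLearner γ (fun _ => 1) W ∧
          ∀ A : LearningAlgorithm (Fin u) m, SatisfiesProperties γ (fun _ => 1) A →
            p ≤ sampleProb 𝒟 m fun s =>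
              C * (d * Real.log (m * γ ^ 2 / d) / (m * γ ^ 2)) ≤
                errorRate 𝒟 (fun _ => 1) ((A (labelled (fun _ => 1) s)).result W) := by
  refine ⟨1 / 10000000, 6000000, 1 / 1680, 1 / 4, by norm_num, by norm_num, by norm_num,
    by norm_num, by norm_num, fun γ d m h0 h1 hd _ hm => ?_⟩
  rcases lt_or_ge 1 (m * γ ^ 2 / d) with hx | hx
  · exact exists_hard_class h0 h1 hd hx hm
  -- Here the logarithm is non-positive, so the error bound is vacuous and a single hypothesis on
  -- one point suffices.
  · have hd0 : 0 ≤ d := (Real.log_nonneg (by rw [le_div_iff₀ h0]; linarith)).trans hd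
    refine ⟨1, uniformDist 1 one_pos, {fun _ => 1}, fun _ _ => 1, uniformDist_apply 1 one_pos, ?_,
      fun D => mem_singleton_self _, fun D => ?_, fun A _ => ?_⟩
    · have h2 := two_pow_hypVCDim_le (singleton_nonempty (fun _ => 1 : Hypothesis (Fin 1)))
      rw [card_singleton] at h2
      have h3 : hypVCDim ({fun _ => 1} : Finset (Hypothesis (Fin 1))) = 0 := by
        by_contra h
        have := Nat.one_lt_two_pow h
        omega
      rw [h3]
      push_cast
      positivity
    · simp only [Label.toReal_one, mul_one, D.sum_eq_one]
      linarith
    · have hσ := piWeight_mem_stdSimplex fun _ : Fin m => (uniformDist 1 one_pos).2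
      have hlog := Real.log_nonpos (by positivity) hx
      rw [sampleProb_eq_wprob]
      have htrue := wprob_add_not hσ fun _ => False
      have hfalse : wprob (piWeight fun _ : Fin m => (uniformDist 1 one_pos).1)
          (fun _ => False) = 0 := by simp [wprob]
      rw [hfalse, zero_add] at htrue
      refine le_trans (by rw [htrue]; norm_num) (wprob_mono hσ.1 fun s _ => ?_) (b := wprob
        (piWeight fun _ : Fin m => (uniformDist 1 one_pos).1) fun _ => ¬ False)
      refine le_trans ?_ (errorRate_nonneg _ _ _)
      have : d * Real.log (m * γ ^ 2 / d) / (m * γ ^ 2) ≤ 0 :=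
        div_nonpos_of_nonpos_of_nonneg (mul_nonpos_of_nonneg_of_nonpos hd0 hlog) (by positivity)
      linarith

end Main
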